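/- Let $\tfrac12\le\theta<1$. Let $\mathcal S_\theta(\mathbb R^d)$ be the space of all $f\in C^\infty(\mathbb R^d)$ such that $\sup_{\alpha,\beta}\sup_x C^{-|\alpha|-|\beta|}(\alpha!\,\beta!)^{-\theta}|x^\alpha\partial^\beta f(x)|<\infty$ for some $C>0$, and let $\mathcal S_\theta'(\mathbb R^d)$ be the space of linear forms $u$ on $\mathcal S_\theta(\mathbb R^d)$ such that for every $\varepsilon>0$ there is $K_\varepsilon$ with $|u(f)|\le K_\varepsilon\sup_{\alpha,\beta,x}\varepsilon^{-|\alpha|-|\beta|}(\alpha!\,\beta!)^{-\theta}|x^\alpha\partial^\beta f(x)|$ for all $f\in\mathcal S_\theta(\mathbb R^d)$. An FBI phase on $\mathbb C^d\times\mathbb R^d$ is a quadratic form $\varphi(z,y)=\frac12\langle Az,z\rangle+\langle Bz,y\rangle+\frac12\langle Cy,y\rangle$ with complex $d\times d$ matrices $A,B,C$ such that $A,C$ are symmetric, $\det B\ne0$ and $\operatorname{Im}C>0$ (the brackets are bilinear). For $u\in\mathcal S_\theta'(\mathbb R^d)$ put $T_\varphi u(z)=c_\varphi\langle u_y,e^{i\varphi(z,y)}\rangle$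 with $c_\varphi=2^{-d/2}\pi^{-3d/4}(\det\operatorname{Im}C)^{-1/4}|\det B|$, and let $\Phi(z)=\max_{y\in\mathbb R^d}(-\operatorname{Im}\varphi(z,y))$. Let $\chi_\varphi^b:T^*\mathbb R^d\to\mathbb C^d$ be the linear bijection that sends $(x,\xi)$ to the point $z$ with $\xi=-\varphi'_y(z,x)=-(Bz+Cx)$. The global wave front set $\mathrm{WF}^\theta_{\mathrm{gl}}(u)\subset T^*\mathbb R^d\setminus\{0\}$, computed with the phase $\varphi$, is the set of all points $p\neq 0$ for which there are no open conic neighbourhood $L\subset\mathbb C^d\setminus\{0\}$ of $\chi^b_\varphi(p)$ and constants $\varepsilon,K>0$ with $$|T_\varphi u(z)|\le K e^{-\varepsilon|z|^{1/\theta}+\Phi(z)}\qquad(z\in L).$$ For a closed cone $\Gamma\subset T^*\mathbb R^d\setminus\{0\}$ (closed in $T^*\mathbb R^d\setminus\{0\}$ and invariant under multiplication by positive reals) let $\mathcal S'_{\theta,\Gamma}(\mathbb R^d)=\{u\in\mathcal S_\theta'(\mathbb R^d):\mathrm{WF}^\theta_{\mathrm{gl}}(u)\subset\Gamma\}$. **Proposition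 (behaviour under tensor products).** Let $\Gamma_1\subset T^*\mathbb R^{d_1}\setminus\{0\}$ and $\Gamma_2\subset T^*\mathbb R^{d_2}\setminus\{0\}$ be closed cones, let $u\in\mathcal S'_{\theta,\Gamma_1}(\mathbb R^{d_1})$ and $v\in\mathcal S'_{\theta,\Gamma_2}(\mathbb R^{d_2})$, and put $$\Gamma=\bigl((\Gamma_1\cup\{0\})\times(\Gamma_2\cup\{0\})\bigr)\setminus\{(0,0)\}\subset T^*\mathbb R^{d_1+d_2}\setminus\{0\},$$ where $((x_1,x_2),(\xi_1,\xi_2))\in T^*\mathbb R^{d_1+d_2}$ is identified with $((x_1,\xi_1),(x_2,\xi_2))$. Then $\Gamma$ is a closed cone, the tensor product $u\otimes v$, given by $\langle u\otimes v,f\rangle=\langle u_x,\langle v_y,f(x,y)\rangle\rangle$ for $f\in\mathcal S_\theta(\mathbb R^{d_1+d_2})$, is a well-defined element of $\mathcal S_\theta'(\mathbb R^{d_1+d_2})$, and $$u\otimes v\in\mathcal S'_{\theta,\Gamma}(\mathbb R^{d_1+d_2}).$$ Here the wave front sets of $u$ and $v$ are computed with arbitrary FBI phases $\varphi_1$ and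 $\varphi_2$, and that of $u\otimes v$ with the phase $(\varphi_1\oplus\varphi_2)((z_1,z_2),(y_1,y_2))=\varphi_1(z_1,y_1)+\varphi_2(z_2,y_2)$. In particular, this covers the standard phases $\langle z,y\rangle+\frac i2|y|^2$ on all three spaces. -/

import Mathlib

open scoped ContDiff Matrix

namespace GelfandShilov

/-- `ℝ^d` with its Euclidean norm. -/
abbrev RSpace (d : ℕ) : Type := EuclideanSpace ℝ (Fin d)

/-- `ℂ^d` with its Euclidean norm. -/
abbrev CSpace (d : ℕ) : Type := EuclideanSpace ℂ (Fin d)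

/-- The phase space `T^*ℝ^d`, with points `(x, ξ)`. -/
abbrev PhaseSpace (d : ℕ) : Type := RSpace d × RSpace d

/-! ### Gelfand–Shilov functions -/

/-- The partial derivative `∂_i f`. -/
noncomputable def pderiv {d : ℕ} (i : Fin d) (f : RSpace d → ℂ) : RSpace d → ℂ :=
  fun x => fderiv ℝ f x (EuclideanSpace.single i 1)

/-- The iterated partial derivative `∂^β f = ∂_1^{β_1} ⋯ ∂_d^{β_d} f` for a multi-index `β`. -/
noncomputable def iterPderiv {d : ℕ} (β : Fin d → ℕ) (f : RSpace d → ℂ) : RSpace d → ℂ :=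
  (List.finRange d).foldr (fun i g => (pderiv i)^[β i] g) f

/-- The length `|α|` of a multi-index. -/
def mlen {d : ℕ} (α : Fin d → ℕ) : ℕ := ∑ i, α i

/-- The factorial `α!` of a multi-index. -/
def mfact {d : ℕ} (α : Fin d → ℕ) : ℕ := ∏ i, (α i).factorial

/-- `sup_{α, β} sup_x C^{-|α|-|β|} (α!)^{-θ} (β!)^{-θ} |x^α ∂^β f(x)| ≤ M`. -/
def GSBound {d : ℕ} (θ C M : ℝ) (f : RSpace d → ℂ) : Prop :=
  ∀ (α β : Fin d → ℕ) (x : RSpace d),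
    |∏ i, x i ^ α i| * ‖iterPderiv β f x‖
      ≤ M * (C ^ (mlen α + mlen β) * ((mfact α : ℝ) ^ θ * (mfact β : ℝ) ^ θ))

/-- Derivative along a list of coordinate directions. -/
noncomputable def listPderiv {d : ℕ} (L : List (Fin d)) (f : RSpace d → ℂ) : RSpace d → ℂ :=
  L.foldr pderiv f

/-- The list of directions that belongs to a multi-index. -/
def dirs {d : ℕ} (β : Fin d → ℕ) : List (Fin d) :=
  (List.finRange d).flatMap fun i => List.replicate (β i) i

theorem iterPderiv_eq {d : ℕ} (β : Fin d → ℕ) (f : RSpace d → ℂ) :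
    iterPderiv β f = listPderiv (dirs β) f := by
  have key : ∀ (i : Fin d) (n : ℕ) (g : RSpace d → ℂ),
      (List.replicate n i).foldr pderiv g = (pderiv i)^[n] g := by
    intro i n g
    induction n with
    | zero => rfl
    | succ n ih => rw [List.replicate_succ, List.foldr_cons, ih, Function.iterate_succ_apply']
  unfold iterPderiv listPderiv dirs
  rw [List.foldr_flatMap]
  simp only [key]

theorem length_dirs {d : ℕ} (β : Fin d → ℕ) : (dirs β).length = mlen β := by
  simp [dirs, mlen, List.length_flatMap, Fin.sum_univ_def]

theorem contDiff_pderiv {d : ℕ} (i : Fin d) {f : RSpace d → ℂ} (hf : ContDiff ℝ ∞ f) :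
    ContDiff ℝ ∞ (pderiv i f) :=
  (hf.fderiv_right (m := ∞) (by simp)).clm_apply contDiff_const

theorem contDiff_listPderiv {d : ℕ} (L : List (Fin d)) {f : RSpace d → ℂ}
    (hf : ContDiff ℝ ∞ f) : ContDiff ℝ ∞ (listPderiv L f) := by
  induction L with
  | nil => exact hf
  | cons i L ih => exact contDiff_pderiv i ih

theorem smooth_differentiableAt {d : ℕ} {f : RSpace d → ℂ} (hf : ContDiff ℝ ∞ f)
    (x : RSpace d) : DifferentiableAt ℝ f x :=
  (hf.differentiable (by simp)) x

theorem pderiv_add {d : ℕ} (i : Fin d) {f g : RSpace d → ℂ} (hf : ContDiff ℝ ∞ f)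
    (hg : ContDiff ℝ ∞ g) : pderiv i (f + g) = pderiv i f + pderiv i g := by
  funext x
  simp only [pderiv, Pi.add_apply]
  rw [fderiv_add (smooth_differentiableAt hf x) (smooth_differentiableAt hg x)]
  rfl

theorem pderiv_smul {d : ℕ} (i : Fin d) (c : ℂ) {f : RSpace d → ℂ} (hf : ContDiff ℝ ∞ f) :
    pderiv i (c • f) = c • pderiv i f := by
  funext x
  simp only [pderiv, Pi.smul_apply]
  rw [fderiv_const_smul (smooth_differentiableAt hf x)]
  rfl

theorem listPderiv_add {d : ℕ} (L : List (Fin d)) {f g : RSpace d → ℂ} (hf : ContDiff ℝ ∞ f)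
    (hg : ContDiff ℝ ∞ g) : listPderiv L (f + g) = listPderiv L f + listPderiv L g := by
  induction L with
  | nil => rfl
  | cons i L ih =>
    change pderiv i (listPderiv L (f + g)) = _
    rw [ih, pderiv_add i (contDiff_listPderiv L hf) (contDiff_listPderiv L hg)]
    rfl

theorem listPderiv_smul {d : ℕ} (L : List (Fin d)) (c : ℂ) {f : RSpace d → ℂ}
    (hf : ContDiff ℝ ∞ f) : listPderiv L (c • f) = c • listPderiv L f := by
  induction L with
  | nil => rfl
  | cons i L ih =>
    change pderiv i (listPderiv L (c • f)) = _
    rw [ih, pderiv_smul i c (contDiff_listPderiv L hf)]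
    rfl

theorem GSBound.nonneg {d : ℕ} {θ C M : ℝ} {f : RSpace d → ℂ} (h : GSBound θ C M f) :
    0 ≤ M := by
  have := h 0 0 0
  simp only [mlen, mfact, Pi.zero_apply, Finset.sum_const_zero, Nat.factorial_zero,
    Finset.prod_const_one, add_zero, pow_zero, Nat.cast_one, Real.one_rpow, mul_one, abs_one, one_mul] at this
  exact (norm_nonneg _).trans this

theorem GSBound.mono {d : ℕ} {θ C C' M : ℝ} {f : RSpace d → ℂ} (h : GSBound θ C M f)
    (hC : 0 < C) (hCC' : C ≤ C') : GSBound θ C' M f := by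
  intro α β x
  refine (h α β x).trans ?_
  have := h.nonneg
  gcongr

/-- The Gelfand–Shilov space `𝒮_θ(ℝ^d) = 𝒮^θ_θ(ℝ^d)`. -/
noncomputable def GS (θ : ℝ) (d : ℕ) : Submodule ℂ (RSpace d → ℂ) where
  carrier := {f | ContDiff ℝ ∞ f ∧ ∃ C > 0, ∃ M, GSBound θ C M f}
  zero_mem' := by
    have hz : ∀ L : List (Fin d), listPderiv L (0 : RSpace d → ℂ) = 0 := by
      intro L
      have := listPderiv_smul L (0 : ℂ) (f := (0 : RSpace d → ℂ)) contDiff_const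
      simpa using this
    refine ⟨contDiff_const, 1, one_pos, 0, fun α β x => ?_⟩
    rw [iterPderiv_eq, hz]
    simp
  add_mem' := by
    rintro f g ⟨hf, C, hC, M, hM⟩ ⟨hg, C', hC', M', hM'⟩
    refine ⟨hf.add hg, max C C', lt_max_of_lt_left hC, M + M', fun α β x => ?_⟩
    have h1 := hM.mono hC (le_max_left C C') α β x
    have h2 := hM'.mono hC' (le_max_right C C') α β x
    rw [iterPderiv_eq] at h1 h2 ⊢
    rw [listPderiv_add _ hf hg, add_mul]
    refine le_trans ?_ (add_le_add h1 h2)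
    rw [← mul_add]
    exact mul_le_mul_of_nonneg_left (norm_add_le _ _) (abs_nonneg _)
  smul_mem' := by
    rintro c f ⟨hf, C, hC, M, hM⟩
    refine ⟨contDiff_const.smul hf, C, hC, ‖c‖ * M, fun α β x => ?_⟩
    have h1 := hM α β x
    rw [iterPderiv_eq] at h1 ⊢
    rw [listPderiv_smul _ c hf, Pi.smul_apply, norm_smul, mul_left_comm, mul_assoc ‖c‖]
    exact mul_le_mul_of_nonneg_left h1 (norm_nonneg _)

/-! ### Tempered ultradistributions -/

/-- Continuity of a linear form on `𝒮_θ(ℝ^d)`: for every `ε > 0` there is a constant `K` such that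
`|u(f)| ≤ K sup_{α, β, x} ε^{-|α|-|β|} (α!)^{-θ} (β!)^{-θ} |x^α ∂^β f(x)|`
(nothing is required of those `f` for which this supremum is infinite). -/
def IsUltradistribution {θ : ℝ} {d : ℕ} (u : GS θ d →ₗ[ℂ] ℂ) : Prop :=
  ∀ ε > 0, ∃ K : ℝ, ∀ (f : GS θ d) (M : ℝ), GSBound θ ε M (f : RSpace d → ℂ) → ‖u f‖ ≤ K * M

/-- The space `𝒮_θ'(ℝ^d)` of tempered ultradistributions. -/
def GSDual (θ : ℝ) (d : ℕ) : Type := {u : GS θ d →ₗ[ℂ] ℂ // IsUltradistribution u}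

/-- The value `⟨u, f⟩`. -/
noncomputable def GSDual.eval {θ : ℝ} {d : ℕ} (u : GSDual θ d) (f : GS θ d) : ℂ := u.1 f

/-- `w = u ⊗ v`, that is `⟨w, f⟩ = ⟨u_x, ⟨v_y, f(x, y)⟩⟩` for all `f ∈ 𝒮_θ(ℝ^{d₁+d₂})`:
every slice `f(x, ·)` is a test function `k`, the function `x ↦ ⟨v, f(x, ·)⟩` is a test
function `g`, and `⟨w, f⟩ = ⟨u, g⟩`. The point `(x, y)` of `ℝ^{d₁+d₂}` is `Fin.append x y`. -/
def IsTensorProduct {θ : ℝ} {d₁ d₂ : ℕ} (u : GSDual θ d₁) (v : GSDual θ d₂)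
    (w : GSDual θ (d₁ + d₂)) : Prop :=
  ∀ f : GS θ (d₁ + d₂), ∃ g : GS θ d₁,
    (∀ x : RSpace d₁, ∃ k : GS θ d₂,
      (∀ y : RSpace d₂,
        (k : RSpace d₂ → ℂ) y = (f : RSpace (d₁ + d₂) → ℂ) (WithLp.toLp 2 (Fin.append x y))) ∧
      (g : RSpace d₁ → ℂ) x = v.eval k) ∧
    w.eval f = u.eval g

/-! ### FBI phases -/

/-- The data of an FBI phase
`φ(z, y) = ½⟨Az, z⟩ + ⟨Bz, y⟩ + ½⟨Cy, y⟩` on `ℂ^d × ℝ^d`. -/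
structure FBIPhase (d : ℕ) where
  A : Matrix (Fin d) (Fin d) ℂ
  B : Matrix (Fin d) (Fin d) ℂ
  C : Matrix (Fin d) (Fin d) ℂ
  symmA : A.IsSymm
  symmC : C.IsSymm
  detB : B.det ≠ 0
  posC : (C.map Complex.im).PosDef

namespace FBIPhase

/-- A real vector as a complex one. -/
def toC {d : ℕ} (y : RSpace d) : Fin d → ℂ := fun i => (y i : ℂ)

/-- The quadratic form `φ(z, y)`; the brackets are bilinear. -/
noncomputable def form {d : ℕ} (φ : FBIPhase d) (z : CSpace d) (y : RSpace d) : ℂ :=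
  (1 / 2) * ((φ.A *ᵥ z.ofLp) ⬝ᵥ z.ofLp) + (φ.B *ᵥ z.ofLp) ⬝ᵥ toC y
    + (1 / 2) * ((φ.C *ᵥ toC y) ⬝ᵥ toC y)

/-- The function `y ↦ e^{iφ(z, y)}`. -/
noncomputable def packet {d : ℕ} (φ : FBIPhase d) (z : CSpace d) : RSpace d → ℂ :=
  fun y => Complex.exp (Complex.I * φ.form z y)

/-- The weight `Φ(z) = max_y (-Im φ(z, y))`. -/
noncomputable def weight {d : ℕ} (φ : FBIPhase d) (z : CSpace d) : ℝ :=
  ⨆ y : RSpace d, -(φ.form z y).im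

/-- The constant `c_φ = 2^{-d/2} π^{-3d/4} (det Im C)^{-1/4} |det B|`. -/
noncomputable def const {d : ℕ} (φ : FBIPhase d) : ℝ :=
  (2 : ℝ) ^ (-(d : ℝ) / 2) * Real.pi ^ (-(3 * (d : ℝ)) / 4)
    * (φ.C.map Complex.im).det ^ (-(1 / 4) : ℝ) * ‖φ.B.det‖

/-- The bijection `χ^b_φ : T^*ℝ^d → ℂ^d`: `χ^b_φ(x, ξ)` is the point `z` with
`ξ = -φ'_y(z, x) = -(Bz + Cx)`. -/
noncomputable def chi {d : ℕ} (φ : FBIPhase d) (p : PhaseSpace d) : CSpace d :=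
  WithLp.toLp 2 (-(φ.B⁻¹ *ᵥ (toC p.2 + φ.C *ᵥ toC p.1)))

/-- The direct sum phase
`(φ₁ ⊕ φ₂)((z₁, z₂), (y₁, y₂)) = φ₁(z₁, y₁) + φ₂(z₂, y₂)`, with block diagonal matrices. -/
noncomputable def directSum {d₁ d₂ : ℕ} (φ₁ : FBIPhase d₁) (φ₂ : FBIPhase d₂) :
    FBIPhase (d₁ + d₂) where
  A := (Matrix.fromBlocks φ₁.A 0 0 φ₂.A).reindex finSumFinEquiv finSumFinEquiv
  B := (Matrix.fromBlocks φ₁.B 0 0 φ₂.B).reindex finSumFinEquiv finSumFinEquiv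
  C := (Matrix.fromBlocks φ₁.C 0 0 φ₂.C).reindex finSumFinEquiv finSumFinEquiv
  symmA := (Matrix.IsSymm.fromBlocks φ₁.symmA (by simp) φ₂.symmA).reindex _
  symmC := (Matrix.IsSymm.fromBlocks φ₁.symmC (by simp) φ₂.symmC).reindex _
  detB := by
    rw [Matrix.det_reindex_self, Matrix.det_fromBlocks_zero₂₁]
    exact mul_ne_zero φ₁.detB φ₂.detB
  posC := by
    have h1 := φ₁.posC
    have h2 := φ₂.posC
    have h : (Matrix.fromBlocks (φ₁.C.map Complex.im) 0 0 (φ₂.C.map Complex.im)).PosDef := by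
      rw [Matrix.posDef_iff_dotProduct_mulVec] at h1 h2 ⊢
      refine ⟨h1.1.fromBlocks (by simp) h2.1, fun x hx => ?_⟩
      rw [Matrix.fromBlocks_mulVec]
      have hs : star x ⬝ᵥ Sum.elim
          ((φ₁.C.map Complex.im) *ᵥ (x ∘ Sum.inl) + (0 : Matrix _ _ ℝ) *ᵥ (x ∘ Sum.inr))
          ((0 : Matrix _ _ ℝ) *ᵥ (x ∘ Sum.inl) + (φ₂.C.map Complex.im) *ᵥ (x ∘ Sum.inr))
          = star (x ∘ Sum.inl) ⬝ᵥ ((φ₁.C.map Complex.im) *ᵥ (x ∘ Sum.inl))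
            + star (x ∘ Sum.inr) ⬝ᵥ ((φ₂.C.map Complex.im) *ᵥ (x ∘ Sum.inr)) := by
        simp [dotProduct, Fintype.sum_sum_type]
      rw [hs]
      by_cases hl : x ∘ Sum.inl = 0
      · have hr : x ∘ Sum.inr ≠ 0 := by
          intro hr
          apply hx
          funext i
          rcases i with i | i
          · exact congrFun hl i
          · exact congrFun hr i
        rw [hl]
        simpa using h2.2 hr
      · have a := h1.2 hl
        by_cases hr : x ∘ Sum.inr = 0
        · rw [hr]
          simpa using a
        · exact add_pos a (h2.2 hr)
    have e : ((Matrix.fromBlocks φ₁.C 0 0 φ₂.C).reindex finSumFinEquiv finSumFinEquiv).map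
        Complex.im = (Matrix.fromBlocks (φ₁.C.map Complex.im) 0 0
          (φ₂.C.map Complex.im)).submatrix finSumFinEquiv.symm finSumFinEquiv.symm := by
      have : (Matrix.fromBlocks φ₁.C 0 0 φ₂.C).map Complex.im
          = Matrix.fromBlocks (φ₁.C.map Complex.im) 0 0 (φ₂.C.map Complex.im) := by
        rw [Matrix.fromBlocks_map]
        congr 1
      rw [← this]
      rfl
    rw [e]
    exact h.submatrix finSumFinEquiv.symm.injective


end FBIPhase

/-! ### Gaussian functions are test functions -/

theorem mfact_one_le {d : ℕ} (α : Fin d → ℕ) : 1 ≤ mfact α :=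
  Finset.prod_pos fun _ _ => Nat.factorial_pos _

theorem mlen_factorial_le {d : ℕ} (α : Fin d → ℕ) :
    ((mlen α).factorial : ℝ) ≤ ((d : ℝ) + 1) ^ mlen α * mfact α := by
  have h1 : mfact α * Nat.multinomial Finset.univ α = (mlen α).factorial :=
    Nat.multinomial_spec Finset.univ α
  have h2 : Nat.multinomial Finset.univ α ≤ d ^ mlen α := by
    have h := Finset.sum_pow_eq_sum_piAntidiag (Finset.univ : Finset (Fin d)) (fun _ => (1 : ℕ))
      (mlen α)
    simp only [Finset.sum_const, Finset.card_univ, Fintype.card_fin, smul_eq_mul, mul_one,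
      one_pow, Finset.prod_const_one] at h
    rw [h]
    exact Finset.single_le_sum (f := fun k => Nat.multinomial Finset.univ k)
      (fun _ _ => Nat.zero_le _) (by simp [mlen])
  rw [← h1, mul_comm]
  push_cast
  have h3 : (Nat.multinomial Finset.univ α : ℝ) ≤ (d : ℝ) ^ mlen α := by exact_mod_cast h2
  have h4 : (d : ℝ) ^ mlen α ≤ ((d : ℝ) + 1) ^ mlen α := by gcongr; linarith
  exact mul_le_mul_of_nonneg_right (h3.trans h4) (Nat.cast_nonneg _)

theorem sqrt_factorial_le {d : ℕ} {θ : ℝ} (hθ : 1 / 2 ≤ θ) (α β : Fin d → ℕ) :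
    √((mlen α + mlen β).factorial : ℝ)
      ≤ (2 * ((d : ℝ) + 1)) ^ (mlen α + mlen β) * ((mfact α : ℝ) ^ θ * (mfact β : ℝ) ^ θ) := by
  have ha : (1 : ℝ) ≤ mfact α := by exact_mod_cast mfact_one_le α
  have hb : (1 : ℝ) ≤ mfact β := by exact_mod_cast mfact_one_le β
  have h1 : ((mlen α + mlen β).factorial : ℝ)
      ≤ 2 ^ (mlen α + mlen β) * ((mlen α).factorial * (mlen β).factorial) := by
    rw [← Nat.add_choose_mul_factorial_mul_factorial]
    push_cast
    rw [mul_assoc]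
    gcongr
    exact_mod_cast Nat.choose_le_two_pow _ _
  have h2 : ((mlen α + mlen β).factorial : ℝ)
      ≤ (2 * ((d : ℝ) + 1)) ^ (mlen α + mlen β) * (mfact α * mfact β) := by
    refine h1.trans ?_
    rw [mul_pow, mul_assoc]
    refine mul_le_mul_of_nonneg_left ?_ (by positivity)
    calc _ ≤ (((d : ℝ) + 1) ^ mlen α * mfact α) * (((d : ℝ) + 1) ^ mlen β * mfact β) := by
          gcongr <;> exact mlen_factorial_le _
      _ = _ := by rw [pow_add]; ring
  have h3 : (1 : ℝ) ≤ (2 * ((d : ℝ) + 1)) ^ (mlen α + mlen β) := by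
    apply one_le_pow₀
    have : (0 : ℝ) ≤ d := Nat.cast_nonneg _
    linarith
  refine (Real.sqrt_le_sqrt h2).trans ?_
  rw [Real.sqrt_eq_rpow, Real.mul_rpow (by positivity) (by positivity),
    Real.mul_rpow (by positivity) (by positivity)]
  gcongr
  calc _ ≤ ((2 * ((d : ℝ) + 1)) ^ (mlen α + mlen β)) ^ (1 : ℝ) :=
        Real.rpow_le_rpow_of_exponent_le h3 (by norm_num)
    _ = _ := Real.rpow_one _

theorem abs_monomial_le {d : ℕ} (α : Fin d → ℕ) (x : RSpace d) :
    |∏ i, x i ^ α i| ≤ ‖x‖ ^ mlen α := by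
  rw [Finset.abs_prod, mlen, ← Finset.prod_pow_eq_pow_sum]
  refine Finset.prod_le_prod (fun i _ => abs_nonneg _) fun i _ => ?_
  rw [abs_pow]
  gcongr
  exact PiLp.norm_apply_le x i

theorem pow_mul_gauss_le {c : ℝ} (hc : 0 < c) (k : ℕ) {r : ℝ} (_hr : 0 ≤ r) :
    r ^ k * Real.exp (-c * r ^ 2) ≤ (√c)⁻¹ ^ k * √(k.factorial : ℝ) := by
  have h1 : (c * r ^ 2) ^ k / k.factorial ≤ Real.exp (c * r ^ 2) :=
    Real.pow_div_factorial_le_exp _ (by positivity) k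
  have hk : (0 : ℝ) < k.factorial := by exact_mod_cast Nat.factorial_pos k
  rw [div_le_iff₀ hk] at h1
  have h2 : (√c * r) ^ k ≤ √(k.factorial : ℝ) * Real.exp (c * r ^ 2) := by
    apply le_of_sq_le_sq _ (by positivity)
    have e1 : ((√c * r) ^ k) ^ 2 = (c * r ^ 2) ^ k := by
      rw [← pow_mul, mul_comm k 2, pow_mul, mul_pow, Real.sq_sqrt hc.le]
    rw [e1, mul_pow (√_), Real.sq_sqrt hk.le]
    have h3 : (1 : ℝ) ≤ Real.exp (c * r ^ 2) := Real.one_le_exp (by positivity)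
    nlinarith [mul_le_mul_of_nonneg_left h3 (mul_nonneg hk.le (zero_le_one.trans h3))]
  have hs : 0 < √c := Real.sqrt_pos.2 hc
  rw [neg_mul, Real.exp_neg, inv_pow, ← div_eq_mul_inv, div_le_iff₀ (Real.exp_pos _), mul_assoc,
    inv_mul_eq_div, le_div_iff₀ (by positivity), mul_comm, ← mul_pow]
  exact h2

theorem pderiv_affine_mul {d : ℕ} (a : ℂ) (q : Fin d → ℂ) (i : Fin d) {g : RSpace d → ℂ}
    (hg : ContDiff ℝ ∞ g) :
    pderiv i (fun y => (a + ∑ j, q j * (y j : ℂ)) * g y)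
      = fun y => (a + ∑ j, q j * (y j : ℂ)) * pderiv i g y + q i * g y := by
  funext x
  have hl : HasLineDerivAt ℝ (fun y : RSpace d => a + ∑ j, q j * (y j : ℂ)) (q i) x
      (EuclideanSpace.single i 1) := by
    have h : ∀ t : ℝ, a + ∑ j, q j * (((x + t • EuclideanSpace.single i (1 : ℝ) : RSpace d) j : ℝ) : ℂ)
        = (a + ∑ j, q j * (x j : ℂ)) + (t : ℂ) * q i := by
      intro t
      simp only [PiLp.add_apply, PiLp.smul_apply, PiLp.single_apply, smul_eq_mul,
        Complex.ofReal_add, mul_add, Finset.sum_add_distrib, add_assoc]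
      simp [mul_comm, apply_ite Complex.ofReal, mul_ite]
    unfold HasLineDerivAt
    simp only [h]
    have := ((Complex.ofRealCLM.hasDerivAt (x := (0 : ℝ))).mul_const (q i)).const_add
      (a + ∑ j, q j * (x j : ℂ))
    simpa using this
  have hld : Differentiable ℝ (fun y : RSpace d => a + ∑ j, q j * (y j : ℂ)) := by
    have : ∀ j, Differentiable ℝ (fun y : RSpace d => (y j : ℂ)) := fun j =>
      Complex.ofRealCLM.differentiable.comp (EuclideanSpace.proj (𝕜 := ℝ) j).differentiable
    fun_prop
  have e : fderiv ℝ (fun y : RSpace d => a + ∑ j, q j * (y j : ℂ)) x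
      (EuclideanSpace.single i 1) = q i := by
    rw [← (hld x).lineDeriv_eq_fderiv]
    exact hl.lineDeriv
  simp only [pderiv]
  rw [fderiv_fun_mul (hld x) (smooth_differentiableAt hg x)]
  simp only [add_apply, smul_apply, smul_eq_mul]
  rw [e]
  ring

theorem listPderiv_affine_mul {d : ℕ} (a : ℂ) (q : Fin d → ℂ) {g : RSpace d → ℂ}
    (hg : ContDiff ℝ ∞ g) (L : List (Fin d)) :
    ∃ T : List (Fin d × List (Fin d)), T.length = L.length ∧
      (∀ p ∈ T, p.2.length + 1 = L.length) ∧
      listPderiv L (fun y => (a + ∑ j, q j * (y j : ℂ)) * g y)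
        = fun y => (a + ∑ j, q j * (y j : ℂ)) * listPderiv L g y
            + (T.map fun p => q p.1 * listPderiv p.2 g y).sum := by
  induction L with
  | nil => exact ⟨[], rfl, by simp, by funext y; simp [listPderiv]⟩
  | cons i L ih =>
    obtain ⟨T, hT, hlen, h⟩ := ih
    refine ⟨(i, L) :: T.map (fun p => (p.1, i :: p.2)), by simp [hT], ?_, ?_⟩
    · simp only [List.mem_cons, List.mem_map]
      rintro p (rfl | ⟨p', hp', rfl⟩)
      · simp
      · simp [hlen p' hp']
    · have hs : ∀ S : List (Fin d × List (Fin d)),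
          ContDiff ℝ ∞ (fun y => (S.map fun p => q p.1 * listPderiv p.2 g y).sum) ∧
          pderiv i (fun y => (S.map fun p => q p.1 * listPderiv p.2 g y).sum)
            = fun y => (S.map fun p => q p.1 * listPderiv (i :: p.2) g y).sum := by
        intro S
        induction S with
        | nil =>
          refine ⟨contDiff_const, ?_⟩
          funext y
          simp [pderiv]
        | cons p S ihS =>
          have hp : ContDiff ℝ ∞ (q p.1 • listPderiv p.2 g) :=
            contDiff_const.smul (contDiff_listPderiv _ hg)
          refine ⟨hp.add ihS.1, ?_⟩
          have := pderiv_add i hp ihS.1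
          rw [pderiv_smul i _ (contDiff_listPderiv _ hg), ihS.2] at this
          exact this
      have hm : ContDiff ℝ ∞ (fun y : RSpace d => (a + ∑ j, q j * (y j : ℂ))) := by
        have : ∀ j, ContDiff ℝ ∞ (fun y : RSpace d => (y j : ℂ)) := fun j =>
          Complex.ofRealCLM.contDiff.comp (EuclideanSpace.proj (𝕜 := ℝ) j).contDiff
        fun_prop
      change pderiv i (listPderiv L _) = _
      rw [h]
      have h2 := pderiv_add i (hm.mul (contDiff_listPderiv L hg)) (hs T).1
      rw [(hs T).2] at h2
      refine h2.trans ?_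
      have h3 := pderiv_affine_mul a q i (contDiff_listPderiv L hg)
      funext y
      have h4 := congrFun h3 y
      simp only [Pi.add_apply, List.map_cons, List.sum_cons, List.map_map, Function.comp_def]
      rw [← add_assoc]
      exact congrArg₂ (· + ·) h4 rfl

theorem gauss_mem_GS {d : ℕ} {θ : ℝ} (hθ : 1 / 2 ≤ θ) {f : RSpace d → ℂ}
    (hf : ContDiff ℝ ∞ f) (a : Fin d → ℂ) (Q : Fin d → Fin d → ℂ)
    (hd : ∀ i, pderiv i f = fun y => (a i + ∑ j, Q i j * (y j : ℂ)) * f y)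
    {c M : ℝ} (hc : 0 < c) (hb : ∀ y, ‖f y‖ ≤ M * Real.exp (-c * ‖y‖ ^ 2)) :
    f ∈ GS θ d := by
  have hM : 0 ≤ M := by
    have := (norm_nonneg _).trans (hb 0)
    simpa using this
  set R : ℝ := ∑ i, ‖a i‖ + ∑ i, ∑ j, ‖Q i j‖ with hR
  have hR0 : 0 ≤ R := by positivity
  have ha : ∀ i, ‖a i‖ ≤ R := fun i =>
    (Finset.single_le_sum (f := fun i => ‖a i‖) (fun _ _ => norm_nonneg _)
      (Finset.mem_univ i)).trans (le_add_of_nonneg_right (by positivity))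
  have hQs : ∀ i, ∑ j, ‖Q i j‖ ≤ R := fun i =>
    (Finset.single_le_sum (f := fun i => ∑ j, ‖Q i j‖) (fun _ _ => by positivity)
      (Finset.mem_univ i)).trans (le_add_of_nonneg_left (by positivity))
  have hQ : ∀ i j, ‖Q i j‖ ≤ R := fun i j =>
    (Finset.single_le_sum (f := fun j => ‖Q i j‖) (fun _ _ => norm_nonneg _)
      (Finset.mem_univ j)).trans (hQs i)
  have hl : ∀ i (y : RSpace d), ‖a i + ∑ j, Q i j * (y j : ℂ)‖ ≤ R + R * ‖y‖ := by
    intro i y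
    refine (norm_add_le _ _).trans (add_le_add (ha i) ?_)
    refine (norm_sum_le _ _).trans ?_
    calc ∑ j, ‖Q i j * (y j : ℂ)‖ ≤ ∑ j, ‖Q i j‖ * ‖y‖ := by
          refine Finset.sum_le_sum fun j _ => ?_
          rw [norm_mul, Complex.norm_real]
          gcongr
          exact PiLp.norm_apply_le y j
      _ = (∑ j, ‖Q i j‖) * ‖y‖ := by rw [Finset.sum_mul]
      _ ≤ R * ‖y‖ := by gcongr; exact hQs i
  set K : ℝ := (√c)⁻¹ with hK
  have hK0 : 0 ≤ K := by positivity
  set S : ℝ := R + R * K + R + 1 with hS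
  have hS1 : 1 ≤ S := by
    have : 0 ≤ R * K := by positivity
    linarith
  have hS0 : 0 ≤ S := zero_le_one.trans hS1
  have main : ∀ n : ℕ, ∀ L : List (Fin d), L.length = n → ∀ (k : ℕ) (y : RSpace d),
      ‖y‖ ^ k * ‖listPderiv L f y‖ ≤ M * K ^ k * S ^ n * √((k + n).factorial : ℝ) := by
    intro n
    induction n using Nat.strong_induction_on with
    | _ n ih =>
    intro L hL k y
    rcases List.eq_nil_or_concat L with rfl | ⟨L', i, rfl⟩
    · simp only [List.length_nil] at hL
      subst hL
      simp only [listPderiv, List.foldr_nil, pow_zero, mul_one, add_zero]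
      calc ‖y‖ ^ k * ‖f y‖ ≤ ‖y‖ ^ k * (M * Real.exp (-c * ‖y‖ ^ 2)) := by gcongr; exact hb y
        _ = M * (‖y‖ ^ k * Real.exp (-c * ‖y‖ ^ 2)) := by ring
        _ ≤ M * (K ^ k * √(k.factorial : ℝ)) := by
          exact mul_le_mul_of_nonneg_left (pow_mul_gauss_le hc k (norm_nonneg y)) hM
        _ = _ := by ring
    · obtain ⟨m, rfl⟩ : ∃ m, n = m + 1 := ⟨L'.length, by simpa using hL.symm⟩
      have hL' : L'.length = m := by simpa using hL
      have e : listPderiv (L' ++ [i]) f = listPderiv L' (pderiv i f) := by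
        simp [listPderiv]
      obtain ⟨T, hT, hlen, hTe⟩ := listPderiv_affine_mul (a i) (Q i) hf L'
      rw [List.concat_eq_append, e, hd i, hTe]
      set F : ℝ := √((k + (m + 1)).factorial : ℝ) with hF
      have hF0 : 0 ≤ F := Real.sqrt_nonneg _
      have f1 : √((k + m).factorial : ℝ) ≤ F := by
        apply Real.sqrt_le_sqrt
        exact_mod_cast Nat.factorial_le (by omega)
      have b1 : ‖y‖ ^ k * ‖(a i + ∑ j, Q i j * (y j : ℂ)) * listPderiv L' f y‖
          ≤ (R + R * K) * (M * K ^ k * S ^ m * F) := by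
        rw [norm_mul]
        have i1 := ih m (by omega) L' hL' k y
        have i2 := ih m (by omega) L' hL' (k + 1) y
        have e2 : k + 1 + m = k + (m + 1) := by omega
        rw [e2, ← hF] at i2
        have i1' : ‖y‖ ^ k * ‖listPderiv L' f y‖ ≤ M * K ^ k * S ^ m * F :=
          i1.trans (by gcongr)
        calc ‖y‖ ^ k * (‖a i + ∑ j, Q i j * (y j : ℂ)‖ * ‖listPderiv L' f y‖)
            ≤ ‖y‖ ^ k * ((R + R * ‖y‖) * ‖listPderiv L' f y‖) := by
              gcongr; exact hl i y
          _ = R * (‖y‖ ^ k * ‖listPderiv L' f y‖)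
              + R * (‖y‖ ^ (k + 1) * ‖listPderiv L' f y‖) := by ring
          _ ≤ R * (M * K ^ k * S ^ m * F) + R * (M * K ^ (k + 1) * S ^ m * F) := by gcongr
          _ = _ := by ring
      have b2 : ‖y‖ ^ k * ‖(T.map fun p => Q i p.1 * listPderiv p.2 f y).sum‖
          ≤ R * (M * K ^ k * S ^ m * F) := by
        rcases m with _ | m
        · have : T = [] := List.length_eq_zero_iff.1 (hT.trans hL')
          subst this
          simp only [List.map_nil, List.sum_nil, norm_zero, mul_zero]
          positivity
        · have hterm : ∀ p ∈ T, ‖y‖ ^ k * ‖Q i p.1 * listPderiv p.2 f y‖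
              ≤ R * (M * K ^ k * S ^ m * √((k + m).factorial : ℝ)) := by
            intro p hp
            have := ih m (by omega) p.2 (by have := hlen p hp; omega) k y
            rw [norm_mul, mul_left_comm]
            exact mul_le_mul (hQ i p.1) this (by positivity) hR0
          have hsum : ∀ U : List (Fin d × List (Fin d)),
              (∀ p ∈ U, ‖y‖ ^ k * ‖Q i p.1 * listPderiv p.2 f y‖
                ≤ R * (M * K ^ k * S ^ m * √((k + m).factorial : ℝ))) →
              ‖y‖ ^ k * ‖(U.map fun p => Q i p.1 * listPderiv p.2 f y).sum‖
                ≤ U.length * (R * (M * K ^ k * S ^ m * √((k + m).factorial : ℝ))) := by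
            intro U
            induction U with
            | nil => simp
            | cons p U ihU =>
              intro hU
              have h1 := hU p (by simp)
              have h2 := ihU fun p' hp' => hU p' (by simp [hp'])
              simp only [List.map_cons, List.sum_cons, List.length_cons, Nat.cast_add,
                Nat.cast_one]
              calc _ ≤ ‖y‖ ^ k * (‖Q i p.1 * listPderiv p.2 f y‖
                    + ‖(U.map fun p => Q i p.1 * listPderiv p.2 f y).sum‖) := by
                    gcongr; exact norm_add_le _ _
                _ ≤ _ := by rw [mul_add]; linarith
          refine (hsum T hterm).trans ?_
          rw [hT, hL']
          have f2 : ((m + 1 : ℕ) : ℝ) * √((k + m).factorial : ℝ) ≤ F := by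
            rw [hF]
            apply Real.le_sqrt_of_sq_le
            rw [mul_pow, Real.sq_sqrt (Nat.cast_nonneg _)]
            have e3 : k + (m + 1 + 1) = (k + m) + 1 + 1 := by omega
            rw [e3, Nat.factorial_succ, Nat.factorial_succ]
            have : (m + 1) ^ 2 * (k + m).factorial
                ≤ (k + m + 1 + 1) * ((k + m + 1) * (k + m).factorial) := by
              rw [← mul_assoc]
              apply Nat.mul_le_mul_right
              nlinarith
            exact_mod_cast this
          calc ((m + 1 : ℕ) : ℝ) * (R * (M * K ^ k * S ^ m * √((k + m).factorial : ℝ)))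
              = R * (M * K ^ k * S ^ m * (((m + 1 : ℕ) : ℝ) * √((k + m).factorial : ℝ))) := by
                ring
            _ ≤ R * (M * K ^ k * S ^ (m + 1) * F) := by
                refine mul_le_mul_of_nonneg_left ?_ hR0
                refine mul_le_mul ?_ f2 (by positivity) (by positivity)
                refine mul_le_mul_of_nonneg_left ?_ (by positivity)
                exact pow_le_pow_right₀ hS1 (Nat.le_succ m)
      calc _ ≤ ‖y‖ ^ k * (‖(a i + ∑ j, Q i j * (y j : ℂ)) * listPderiv L' f y‖
            + ‖(T.map fun p => Q i p.1 * listPderiv p.2 f y).sum‖) := by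
            gcongr; exact norm_add_le _ _
        _ ≤ (R + R * K) * (M * K ^ k * S ^ m * F) + R * (M * K ^ k * S ^ m * F) := by
            rw [mul_add]; exact add_le_add b1 b2
        _ = (S - 1) * (M * K ^ k * S ^ m * F) := by rw [hS]; ring
        _ ≤ S * (M * K ^ k * S ^ m * F) := by gcongr; linarith
        _ = _ := by rw [hF]; ring
  refine ⟨hf, (K + S) * (2 * ((d : ℝ) + 1)), by positivity, M, fun α β x => ?_⟩
  rw [iterPderiv_eq]
  calc |∏ i, x i ^ α i| * ‖listPderiv (dirs β) f x‖
      ≤ ‖x‖ ^ mlen α * ‖listPderiv (dirs β) f x‖ := by gcongr; exact abs_monomial_le α x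
    _ ≤ M * K ^ mlen α * S ^ mlen β * √((mlen α + mlen β).factorial : ℝ) :=
        main _ _ (length_dirs β) _ _
    _ ≤ M * (K + S) ^ mlen α * (K + S) ^ mlen β
          * ((2 * ((d : ℝ) + 1)) ^ (mlen α + mlen β) * ((mfact α : ℝ) ^ θ * (mfact β : ℝ) ^ θ)) := by
        gcongr
        · linarith
        · linarith
        · exact sqrt_factorial_le hθ α β
    _ = _ := by rw [mul_pow (K + S), pow_add (K + S)]; ring

namespace FBIPhase

theorem form_line {d : ℕ} (φ : FBIPhase d) (z : CSpace d) (y : RSpace d) (i : Fin d) (t : ℝ) :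
    φ.form z (y + t • EuclideanSpace.single i (1 : ℝ))
      = φ.form z y + t * ((φ.B *ᵥ z.ofLp) i + ∑ j, φ.C i j * (y j : ℂ))
        + t ^ 2 * (φ.C i i / 2) := by
  have e : toC (y + t • EuclideanSpace.single i (1 : ℝ)) = toC y + (t : ℂ) • Pi.single i 1 := by
    funext j
    simp only [toC, PiLp.add_apply, PiLp.smul_apply, PiLp.single_apply, smul_eq_mul,
      Pi.add_apply, Pi.smul_apply, Pi.single_apply, Complex.ofReal_add, Complex.ofReal_mul]
    split_ifs <;> simp
  have h1 : (φ.C *ᵥ Pi.single i 1) ⬝ᵥ toC y = ∑ j, φ.C i j * (y j : ℂ) := by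
    simp only [Matrix.mulVec_single_one, dotProduct, toC, Matrix.col_apply]
    exact Finset.sum_congr rfl fun j _ => by rw [φ.symmC.apply i j]
  have h2 : (φ.C *ᵥ toC y) i = ∑ j, φ.C i j * (y j : ℂ) := rfl
  unfold form
  rw [e, Matrix.mulVec_add, Matrix.mulVec_smul, dotProduct_add, add_dotProduct, dotProduct_add,
    dotProduct_add, smul_dotProduct, smul_dotProduct, dotProduct_smul, dotProduct_smul,
    dotProduct_smul, h1, dotProduct_single_one, dotProduct_single_one, dotProduct_single_one, h2]
  simp only [Matrix.mulVec_single_one, Matrix.col_apply, smul_eq_mul]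
  ring

theorem contDiff_toC {d : ℕ} (j : Fin d) : ContDiff ℝ ∞ (fun y : RSpace d => toC y j) :=
  Complex.ofRealCLM.contDiff.comp (EuclideanSpace.proj (𝕜 := ℝ) j).contDiff

theorem contDiff_packet {d : ℕ} (φ : FBIPhase d) (z : CSpace d) :
    ContDiff ℝ ∞ (φ.packet z) := by
  have h := contDiff_toC (d := d)
  unfold packet form
  simp only [dotProduct, Matrix.mulVec]
  refine Complex.contDiff_exp.comp ?_
  fun_prop

theorem pderiv_packet {d : ℕ} (φ : FBIPhase d) (z : CSpace d) (i : Fin d) :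
    pderiv i (φ.packet z) = fun y =>
      (Complex.I * (φ.B *ᵥ z.ofLp) i + ∑ j, Complex.I * φ.C i j * (y j : ℂ)) * φ.packet z y := by
  funext y
  have hd := smooth_differentiableAt (contDiff_packet φ z) y
  unfold pderiv
  rw [← hd.lineDeriv_eq_fderiv]
  apply HasLineDerivAt.lineDeriv
  unfold HasLineDerivAt packet
  simp only [form_line]
  have ht : HasDerivAt (fun t : ℝ => (t : ℂ)) 1 0 := Complex.ofRealCLM.hasDerivAt
  have h := ((((ht.mul_const ((φ.B *ᵥ z.ofLp) i + ∑ j, φ.C i j * (y j : ℂ))).const_add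
    (φ.form z y)).add ((ht.pow 2).mul_const (φ.C i i / 2))).const_mul Complex.I).cexp
  have e : ∑ j, Complex.I * φ.C i j * (y j : ℂ) = Complex.I * ∑ j, φ.C i j * (y j : ℂ) := by
    rw [Finset.mul_sum]
    exact Finset.sum_congr rfl fun j _ => by ring
  refine HasDerivAt.congr_deriv h ?_
  rw [e]
  simp
  ring

theorem exists_coercive {d : ℕ} {P : Matrix (Fin d) (Fin d) ℝ} (hP : P.PosDef) :
    ∃ c > 0, ∀ y : RSpace d, c * ‖y‖ ^ 2 ≤ (P *ᵥ y.ofLp) ⬝ᵥ y.ofLp := by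
  rw [Matrix.posDef_iff_dotProduct_mulVec] at hP
  have hpos : ∀ y : RSpace d, y ≠ 0 → 0 < (P *ᵥ y.ofLp) ⬝ᵥ y.ofLp := by
    intro y hy
    have h := hP.2 (x := y.ofLp) (by simpa using hy)
    rwa [star_trivial, dotProduct_comm] at h
  have hcont : Continuous fun y : RSpace d => (P *ᵥ y.ofLp) ⬝ᵥ y.ofLp := by
    simp only [dotProduct, Matrix.mulVec]
    fun_prop
  rcases (Metric.sphere (0 : RSpace d) 1).eq_empty_or_nonempty with he | hne
  · refine ⟨1, one_pos, fun y => ?_⟩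
    have hy : y = 0 := by
      by_contra hy
      have : (‖y‖⁻¹ • y) ∈ Metric.sphere (0 : RSpace d) 1 := by
        simp [norm_smul, hy]
      rw [he] at this
      exact this
    simp [hy]
  · obtain ⟨y₀, hy₀, hmin⟩ := (isCompact_sphere (0 : RSpace d) 1).exists_isMinOn hne
      hcont.continuousOn
    refine ⟨(P *ᵥ y₀.ofLp) ⬝ᵥ y₀.ofLp, hpos y₀ ?_, fun y => ?_⟩
    · rintro rfl
      simp at hy₀
    · by_cases hy : y = 0
      · simp [hy]
      have hn : 0 < ‖y‖ := norm_pos_iff.2 hy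
      have hmem : (‖y‖⁻¹ • y) ∈ Metric.sphere (0 : RSpace d) 1 := by
        simp [norm_smul, hy]
      have h := hmin hmem
      simp only [Set.mem_ofPred_eq, WithLp.ofLp_smul, Matrix.mulVec_smul, smul_dotProduct,
        dotProduct_smul, smul_eq_mul] at h
      rw [← mul_assoc, ← mul_inv, inv_mul_eq_div, le_div_iff₀ (by positivity)] at h
      rw [pow_two]
      exact h

theorem packet_bound {d : ℕ} (φ : FBIPhase d) (z : CSpace d) :
    ∃ c > 0, ∃ M : ℝ, ∀ y, ‖φ.packet z y‖ ≤ M * Real.exp (-c * ‖y‖ ^ 2) := by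
  obtain ⟨c, hc, hcoer⟩ := exists_coercive φ.posC
  set m : ℝ := ((1 / 2) * ((φ.A *ᵥ z.ofLp) ⬝ᵥ z.ofLp)).im with hm
  set b : ℝ := ∑ i, ‖(φ.B *ᵥ z.ofLp) i‖ with hb
  refine ⟨c / 4, by positivity, Real.exp (-m + b ^ 2 / c), fun y => ?_⟩
  have h1 : ((φ.B *ᵥ z.ofLp) ⬝ᵥ toC y).im ≥ -(b * ‖y‖) := by
    have : ‖(φ.B *ᵥ z.ofLp) ⬝ᵥ toC y‖ ≤ b * ‖y‖ := by
      rw [dotProduct, hb, Finset.sum_mul]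
      refine (norm_sum_le _ _).trans (Finset.sum_le_sum fun i _ => ?_)
      rw [norm_mul, toC, Complex.norm_real]
      gcongr
      exact PiLp.norm_apply_le y i
    exact neg_le_of_abs_le ((Complex.abs_im_le_norm _).trans this)
  have h2 : ((1 / 2) * ((φ.C *ᵥ toC y) ⬝ᵥ toC y)).im
      = (1 / 2) * (((φ.C.map Complex.im) *ᵥ y.ofLp) ⬝ᵥ y.ofLp) := by
    have e : ((φ.C *ᵥ toC y) ⬝ᵥ toC y).im = ((φ.C.map Complex.im) *ᵥ y.ofLp) ⬝ᵥ y.ofLp := by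
      simp [dotProduct, Matrix.mulVec, toC, Finset.sum_mul, Complex.im_sum]
    rw [← e]
    simp [Complex.mul_im]
  have h3 := hcoer y
  have h4 : -(φ.form z y).im ≤ -m + b ^ 2 / c + -(c / 4) * ‖y‖ ^ 2 := by
    unfold form
    rw [Complex.add_im, Complex.add_im, h2, ← hm]
    have h5 : b * ‖y‖ ≤ b ^ 2 / c + c / 4 * ‖y‖ ^ 2 := by
      have : b ^ 2 / c + c / 4 * ‖y‖ ^ 2 - b * ‖y‖ = (b - c / 2 * ‖y‖) ^ 2 / c := by
        field_simp
        ring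
      have h6 : 0 ≤ (b - c / 2 * ‖y‖) ^ 2 / c := by positivity
      linarith
    linarith
  rw [packet, Complex.norm_exp, ← Real.exp_add]
  apply Real.exp_le_exp.2
  simpa using h4

/-- The function `e^{iφ(z, ·)}` belongs to `𝒮_θ(ℝ^d)` for `θ ≥ 1/2`. -/
theorem packet_mem_GS {d : ℕ} {θ : ℝ} (hθ : 1 / 2 ≤ θ) (φ : FBIPhase d) (z : CSpace d) :
    φ.packet z ∈ GS θ d := by
  obtain ⟨c, hc, M, h⟩ := packet_bound φ z
  exact gauss_mem_GS hθ (contDiff_packet φ z) _ _ (pderiv_packet φ z) hc h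

end FBIPhase

/-- The FBI transform `T_φ u(z) = c_φ ⟨u_y, e^{iφ(z, y)}⟩`. -/
noncomputable def fbiTransform {d : ℕ} {θ : ℝ} (hθ : 1 / 2 ≤ θ) (φ : FBIPhase d)
    (u : GSDual θ d) (z : CSpace d) : ℂ :=
  φ.const * u.eval ⟨φ.packet z, φ.packet_mem_GS hθ z⟩

/-! ### The global wave front set -/

/-- Invariance under multiplication by positive reals. -/
def IsConic {E : Type*} [SMul ℝ E] (Γ : Set E) : Prop :=
  ∀ p ∈ Γ, ∀ t : ℝ, 0 < t → t • p ∈ Γ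

/-- A closed conic subset of `T^*ℝ^d ∖ {0}` (closed relative to `T^*ℝ^d ∖ {0}`). -/
def IsClosedCone {d : ℕ} (Γ : Set (PhaseSpace d)) : Prop :=
  (0 : PhaseSpace d) ∉ Γ ∧ IsConic Γ ∧ closure Γ ⊆ Γ ∪ {0}

/-- The wave front set `WF^θ_gl(u) ⊆ T^*ℝ^d ∖ {0}`, defined with the phase `φ`: the point `p ≠ 0`
does not belong to it if there are an open conic neighbourhood `L` of `χ^b_φ(p)` in
`ℂ^d ∖ {0}` and `ε > 0`, `K` with `|T_φ u(z)| ≤ K e^{-ε|z|^{1/θ} + Φ(z)}` for all `z ∈ L`. -/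
def WF {d : ℕ} {θ : ℝ} (hθ : 1 / 2 ≤ θ) (φ : FBIPhase d) (u : GSDual θ d) :
    Set (PhaseSpace d) :=
  {p | p ≠ 0 ∧ ¬ ∃ L : Set (CSpace d), IsOpen L ∧ IsConic L ∧ (0 : CSpace d) ∉ L ∧ φ.chi p ∈ L ∧
    ∃ ε > 0, ∃ K : ℝ, ∀ z ∈ L,
      ‖fbiTransform hθ φ u z‖ ≤ K * Real.exp (-ε * ‖z‖ ^ (1 / θ) + φ.weight z)}

/-- The set `𝒮'_{θ,Γ}(ℝ^d)` of the ultradistributions with wave front set in `Γ`. -/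
def GSDualCone {d : ℕ} {θ : ℝ} (hθ : 1 / 2 ≤ θ) (φ : FBIPhase d) (Γ : Set (PhaseSpace d)) :
    Set (GSDual θ d) :=
  {u | WF hθ φ u ⊆ Γ}

/-- The projection of `ℝ^{d₁+d₂}` to the first `d₁` coordinates. -/
def fstR {d₁ d₂ : ℕ} (x : RSpace (d₁ + d₂)) : RSpace d₁ :=
  WithLp.toLp 2 fun i => x (Fin.castAdd d₂ i)

/-- The projection of `ℝ^{d₁+d₂}` to the last `d₂` coordinates. -/
def sndR {d₁ d₂ : ℕ} (x : RSpace (d₁ + d₂)) : RSpace d₂ :=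
  WithLp.toLp 2 fun j => x (Fin.natAdd d₁ j)

/-- The set `((Γ₁ ∪ {0}) × (Γ₂ ∪ {0})) ∖ {(0, 0)}` in `T^*ℝ^{d₁+d₂} = T^*ℝ^{d₁} × T^*ℝ^{d₂}`,
where `((x₁, x₂), (ξ₁, ξ₂))` is identified with `((x₁, ξ₁), (x₂, ξ₂))`. -/
def prodCone {d₁ d₂ : ℕ} (Γ₁ : Set (PhaseSpace d₁)) (Γ₂ : Set (PhaseSpace d₂)) :
    Set (PhaseSpace (d₁ + d₂)) :=
  {p | (fstR p.1, fstR p.2) ∈ Γ₁ ∪ {0} ∧ (sndR p.1, sndR p.2) ∈ Γ₂ ∪ {0}} \ {0}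

end GelfandShilov

open GelfandShilov

namespace GelfandShilov

/-! ### Commuting partial derivatives -/

theorem pderiv_comm {d : ℕ} (i j : Fin d) {f : RSpace d → ℂ} (hf : ContDiff ℝ ∞ f) :
    pderiv i (pderiv j f) = pderiv j (pderiv i f) := by
  have key : ∀ (v w x : RSpace d), fderiv ℝ (fun x => fderiv ℝ f x v) x w
      = fderiv ℝ (fderiv ℝ f) x w v := by
    intro v w x
    have h : DifferentiableAt ℝ (fderiv ℝ f) x :=
      ((hf.fderiv_right (m := ∞) (by simp)).differentiable (by simp)) x
    rw [fderiv_clm_apply h (differentiableAt_const v)]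
    simp
  funext x
  unfold pderiv
  rw [key, key]
  refine (hf.contDiffAt.isSymmSndFDerivAt ?_).eq _ _
  rw [minSmoothness_of_isRCLikeNormedField]
  exact WithTop.coe_le_coe.2 le_top

theorem listPderiv_append {d : ℕ} (L L' : List (Fin d)) (f : RSpace d → ℂ) :
    listPderiv (L ++ L') f = listPderiv L (listPderiv L' f) := by
  simp [listPderiv]

theorem listPderiv_perm {d : ℕ} {L L' : List (Fin d)} (h : L.Perm L') {f : RSpace d → ℂ}
    (hf : ContDiff ℝ ∞ f) : listPderiv L f = listPderiv L' f := by
  induction h with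
  | nil => rfl
  | cons i _ ih => exact congrArg (pderiv i) ih
  | swap i j l => exact pderiv_comm j i (contDiff_listPderiv l hf)
  | trans _ _ ih₁ ih₂ => exact ih₁.trans ih₂

theorem count_dirs {d : ℕ} (β : Fin d → ℕ) (i : Fin d) : (dirs β).count i = β i := by
  unfold dirs
  rw [List.count_flatMap]
  simp only [Function.comp_def, List.count_replicate]
  rw [← Fin.sum_univ_def]
  simp

theorem perm_dirs {d : ℕ} {L : List (Fin d)} {β : Fin d → ℕ} (h : ∀ i, L.count i = β i) :
    L.Perm (dirs β) :=
  List.perm_iff_count.2 fun i => by rw [h, count_dirs]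

theorem listPderiv_eq_iterPderiv {d : ℕ} {L : List (Fin d)} {β : Fin d → ℕ}
    (h : ∀ i, L.count i = β i) {f : RSpace d → ℂ} (hf : ContDiff ℝ ∞ f) :
    listPderiv L f = iterPderiv β f := by
  rw [iterPderiv_eq, listPderiv_perm (perm_dirs h) hf]

theorem GSBound.pderiv {d : ℕ} {θ C M : ℝ} (hθ : θ ≤ 1) (hC : 0 < C)
    {f : RSpace d → ℂ} (hf : ContDiff ℝ ∞ f) (h : GSBound θ C M f) (i : Fin d) :
    GSBound θ (2 * C) (C * M) (pderiv i f) := by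
  intro α β x
  have hM := h.nonneg
  have e : iterPderiv β (GelfandShilov.pderiv i f) = iterPderiv (β + Pi.single i 1) f := by
    rw [iterPderiv_eq, ← listPderiv_eq_iterPderiv (L := dirs β ++ [i]) _ hf, listPderiv_append]
    · rfl
    · intro j
      rw [List.count_append, count_dirs]
      by_cases hj : i = j
      · subst hj; simp
      · simp [hj, Ne.symm hj]
  have hlen : mlen (β + Pi.single i 1) = mlen β + 1 := by
    simp [mlen, Finset.sum_add_distrib]
  have hfact : mfact (β + Pi.single i 1) = (β i + 1) * mfact β := by
    unfold mfact
    rw [← Finset.mul_prod_erase _ _ (Finset.mem_univ i),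
      ← Finset.mul_prod_erase _ (fun j => (β j).factorial) (Finset.mem_univ i), ← mul_assoc]
    congr 1
    · simp [Nat.factorial_succ]
    · refine Finset.prod_congr rfl fun j hj => ?_
      simp [Finset.ne_of_mem_erase hj]
  have hpow : ((β i + 1 : ℕ) : ℝ) ^ θ ≤ 2 ^ (mlen α + mlen β) := by
    have h1 : (1 : ℝ) ≤ ((β i + 1 : ℕ) : ℝ) := by simp
    calc ((β i + 1 : ℕ) : ℝ) ^ θ ≤ ((β i + 1 : ℕ) : ℝ) ^ (1 : ℝ) :=
          Real.rpow_le_rpow_of_exponent_le h1 hθ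
      _ = ((β i + 1 : ℕ) : ℝ) := Real.rpow_one _
      _ ≤ ((2 ^ β i : ℕ) : ℝ) := by exact_mod_cast Nat.lt_two_pow_self
      _ ≤ 2 ^ (mlen α + mlen β) := by
          push_cast
          refine pow_le_pow_right₀ (by norm_num) ?_
          exact (Finset.single_le_sum (f := β) (fun _ _ => Nat.zero_le _)
            (Finset.mem_univ i)).trans (Nat.le_add_left _ _)
  rw [e]
  refine (h α _ x).trans ?_
  rw [hlen, hfact, Nat.cast_mul, Real.mul_rpow (by positivity) (by positivity)]
  calc M * (C ^ (mlen α + (mlen β + 1))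
        * ((mfact α : ℝ) ^ θ * (((β i + 1 : ℕ) : ℝ) ^ θ * (mfact β : ℝ) ^ θ)))
      ≤ M * (C ^ (mlen α + (mlen β + 1))
        * ((mfact α : ℝ) ^ θ * (2 ^ (mlen α + mlen β) * (mfact β : ℝ) ^ θ))) := by gcongr
    _ = _ := by rw [mul_pow, ← add_assoc, pow_succ]; ring

theorem pderiv_mem_GS {d : ℕ} {θ : ℝ} (hθ : θ ≤ 1) {f : RSpace d → ℂ}
    (hf : f ∈ GS θ d) (i : Fin d) : pderiv i f ∈ GS θ d := by
  obtain ⟨hs, C, hC, M, hM⟩ := hf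
  exact ⟨contDiff_pderiv i hs, 2 * C, by positivity, C * M, hM.pderiv hθ hC hs i⟩

/-! ### Slices -/

/-- The point `(x, y)` of `ℝ^{d₁+d₂}`. -/
noncomputable def join {d₁ d₂ : ℕ} (x : RSpace d₁) (y : RSpace d₂) : RSpace (d₁ + d₂) :=
  WithLp.toLp 2 (Fin.append x y)

@[simp] theorem join_castAdd {d₁ d₂ : ℕ} (x : RSpace d₁) (y : RSpace d₂) (i : Fin d₁) :
    join x y (Fin.castAdd d₂ i) = x i := by
  simp [join]

@[simp] theorem join_natAdd {d₁ d₂ : ℕ} (x : RSpace d₁) (y : RSpace d₂) (j : Fin d₂) :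
    join x y (Fin.natAdd d₁ j) = y j := by
  simp [join]

theorem contDiff_join {d₁ d₂ : ℕ} :
    ContDiff ℝ ∞ (fun p : RSpace d₁ × RSpace d₂ => join p.1 p.2) := by
  rw [contDiff_euclidean]
  intro i
  induction i using Fin.addCases with
  | left i =>
    simp only [join_castAdd]
    exact (EuclideanSpace.proj (𝕜 := ℝ) i).contDiff.comp contDiff_fst
  | right j =>
    simp only [join_natAdd]
    exact (EuclideanSpace.proj (𝕜 := ℝ) j).contDiff.comp contDiff_snd

theorem join_add_left {d₁ d₂ : ℕ} (x : RSpace d₁) (y : RSpace d₂) (i : Fin d₁) (t : ℝ) :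
    join (x + t • EuclideanSpace.single i (1 : ℝ)) y
      = join x y + t • EuclideanSpace.single (Fin.castAdd d₂ i) (1 : ℝ) := by
  ext k
  induction k using Fin.addCases with
  | left k => simp [PiLp.single_apply]
  | right k =>
    have : Fin.natAdd d₁ k ≠ Fin.castAdd d₂ i := by
      simp [Fin.ext_iff]; omega
    simp [this]

theorem join_add_right {d₁ d₂ : ℕ} (x : RSpace d₁) (y : RSpace d₂) (j : Fin d₂) (t : ℝ) :
    join x (y + t • EuclideanSpace.single j (1 : ℝ))
      = join x y + t • EuclideanSpace.single (Fin.natAdd d₁ j) (1 : ℝ) := by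
  ext k
  induction k using Fin.addCases with
  | left k =>
    have : Fin.castAdd d₂ k ≠ Fin.natAdd d₁ j := by
      simp [Fin.ext_iff]; omega
    simp [this]
  | right k => simp [PiLp.single_apply]

/-- The function `F(x, ·)`. -/
noncomputable def slice {d₁ d₂ : ℕ} (F : RSpace (d₁ + d₂) → ℂ) (x : RSpace d₁) : RSpace d₂ → ℂ :=
  fun y => F (join x y)

/-- The function `F(·, y)`. -/
noncomputable def coslice {d₁ d₂ : ℕ} (F : RSpace (d₁ + d₂) → ℂ) (y : RSpace d₂) : RSpace d₁ → ℂ :=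
  fun x => F (join x y)

theorem contDiff_slice {d₁ d₂ : ℕ} {F : RSpace (d₁ + d₂) → ℂ} (hF : ContDiff ℝ ∞ F)
    (x : RSpace d₁) : ContDiff ℝ ∞ (slice F x) :=
  hF.comp (contDiff_join.comp (contDiff_const.prodMk contDiff_id))

theorem contDiff_coslice {d₁ d₂ : ℕ} {F : RSpace (d₁ + d₂) → ℂ} (hF : ContDiff ℝ ∞ F)
    (y : RSpace d₂) : ContDiff ℝ ∞ (coslice F y) :=
  hF.comp (contDiff_join.comp (contDiff_id.prodMk contDiff_const))

theorem pderiv_eq_deriv {d : ℕ} {f : RSpace d → ℂ} (hf : ContDiff ℝ ∞ f) (i : Fin d)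
    (x : RSpace d) :
    pderiv i f x = deriv (fun t : ℝ => f (x + t • EuclideanSpace.single i (1 : ℝ))) 0 :=
  (smooth_differentiableAt hf x).lineDeriv_eq_fderiv.symm

theorem pderiv_slice {d₁ d₂ : ℕ} {F : RSpace (d₁ + d₂) → ℂ} (hF : ContDiff ℝ ∞ F)
    (x : RSpace d₁) (j : Fin d₂) :
    pderiv j (slice F x) = slice (pderiv (Fin.natAdd d₁ j) F) x := by
  funext y
  rw [pderiv_eq_deriv (contDiff_slice hF x), slice, pderiv_eq_deriv hF]
  simp only [slice, join_add_right]

theorem pderiv_coslice {d₁ d₂ : ℕ} {F : RSpace (d₁ + d₂) → ℂ} (hF : ContDiff ℝ ∞ F)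
    (y : RSpace d₂) (i : Fin d₁) :
    pderiv i (coslice F y) = coslice (pderiv (Fin.castAdd d₂ i) F) y := by
  funext x
  rw [pderiv_eq_deriv (contDiff_coslice hF y), coslice, pderiv_eq_deriv hF]
  simp only [coslice, join_add_left]

theorem listPderiv_slice {d₁ d₂ : ℕ} {F : RSpace (d₁ + d₂) → ℂ} (hF : ContDiff ℝ ∞ F)
    (x : RSpace d₁) (L : List (Fin d₂)) :
    listPderiv L (slice F x) = slice (listPderiv (L.map (Fin.natAdd d₁)) F) x := by
  induction L with
  | nil => rfl
  | cons j L ih =>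
    change pderiv j (listPderiv L (slice F x)) = _
    rw [ih, pderiv_slice (contDiff_listPderiv _ hF)]
    rfl

theorem listPderiv_map_append {d₁ d₂ : ℕ} {F : RSpace (d₁ + d₂) → ℂ} (hF : ContDiff ℝ ∞ F)
    (b : Fin d₁ → ℕ) (β : Fin d₂ → ℕ) :
    listPderiv ((dirs β).map (Fin.natAdd d₁)) (listPderiv ((dirs b).map (Fin.castAdd d₂)) F)
      = iterPderiv (Fin.append b β) F := by
  rw [← listPderiv_append]
  refine listPderiv_eq_iterPderiv (fun k => ?_) hF
  rw [List.count_append]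
  induction k using Fin.addCases with
  | left k =>
    rw [List.count_map_of_injective _ _ (Fin.castAdd_injective d₁ d₂), count_dirs,
      List.count_eq_zero_of_not_mem]
    · simp
    · simp only [List.mem_map, not_exists, not_and, Fin.ext_iff, Fin.val_natAdd, Fin.val_castAdd]
      omega
  | right k =>
    rw [List.count_map_of_injective _ _ (Fin.natAdd_injective d₂ d₁), count_dirs,
      List.count_eq_zero_of_not_mem (l := (dirs b).map _)]
    · simp
    · simp only [List.mem_map, not_exists, not_and, Fin.ext_iff, Fin.val_natAdd, Fin.val_castAdd]
      omega

theorem mlen_append {d₁ d₂ : ℕ} (a : Fin d₁ → ℕ) (α : Fin d₂ → ℕ) :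
    mlen (Fin.append a α) = mlen a + mlen α := by
  simp [mlen, Fin.sum_univ_add]

theorem mfact_append {d₁ d₂ : ℕ} (a : Fin d₁ → ℕ) (α : Fin d₂ → ℕ) :
    mfact (Fin.append a α) = mfact a * mfact α := by
  simp [mfact, Fin.prod_univ_add]

/-- The functions `x^a ∂_x^b F(x, ·)` are bounded in `𝒮_θ`, uniformly in `x`. -/
theorem GSBound.slice {d₁ d₂ : ℕ} {θ C M : ℝ} {F : RSpace (d₁ + d₂) → ℂ}
    (hF : ContDiff ℝ ∞ F) (h : GSBound θ C M F) (a b : Fin d₁ → ℕ) (x : RSpace d₁) :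
    GSBound θ C (M * (C ^ (mlen a + mlen b) * ((mfact a : ℝ) ^ θ * (mfact b : ℝ) ^ θ)))
      (((∏ i, x i ^ a i : ℝ) : ℂ) •
        GelfandShilov.slice (listPderiv ((dirs b).map (Fin.castAdd d₂)) F) x) := by
  intro α β y
  have hs := contDiff_listPderiv ((dirs b).map (Fin.castAdd d₂)) hF
  rw [iterPderiv_eq, listPderiv_smul _ _ (contDiff_slice hs x), listPderiv_slice hs,
    listPderiv_map_append hF, Pi.smul_apply, norm_smul, Complex.norm_real, Real.norm_eq_abs]
  have h1 := h (Fin.append a α) (Fin.append b β) (join x y)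
  simp only [Fin.prod_univ_add, Fin.append_left, Fin.append_right, join_castAdd, join_natAdd,
    mlen_append, mfact_append, abs_mul, Nat.cast_mul] at h1
  rw [Real.mul_rpow (by positivity) (by positivity),
    Real.mul_rpow (by positivity) (by positivity)] at h1
  refine le_trans (le_of_eq ?_) (h1.trans (le_of_eq ?_))
  · simp only [GelfandShilov.slice]; ring
  · ring

theorem GSBound.slice_zero {d₁ d₂ : ℕ} {θ C M : ℝ} {F : RSpace (d₁ + d₂) → ℂ}
    (hF : ContDiff ℝ ∞ F) (h : GSBound θ C M F) (x : RSpace d₁) :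
    GSBound θ C M (GelfandShilov.slice F x) := by
  have := h.slice hF 0 0 x
  have e : dirs (0 : Fin d₁ → ℕ) = [] := by simp [dirs]
  simpa [mlen, mfact, e, listPderiv] using this

/-! ### Growth of the wave packets -/

/-- The derivatives of a function with `∂_i f = (a_i + ∑_j Q_{ij} y_j) f`. -/
theorem norm_listPderiv_le_of_affine {d : ℕ} {f : RSpace d → ℂ} (hf : ContDiff ℝ ∞ f)
    (a : Fin d → ℂ) (Q : Fin d → Fin d → ℂ)
    (hd : ∀ i, pderiv i f = fun y => (a i + ∑ j, Q i j * (y j : ℂ)) * f y)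
    {R s : ℝ} (hR : 1 ≤ R) (hs : 0 ≤ s) (y : RSpace d)
    (hQ : ∀ i j, ‖Q i j‖ ≤ R) (hl : ∀ i, ‖a i + ∑ j, Q i j * (y j : ℂ)‖ ≤ R * s) :
    ∀ n : ℕ, ∀ L : List (Fin d), L.length = n →
      ‖listPderiv L f y‖ ≤ (2 * R) ^ n * (s + √n) ^ n * ‖f y‖ := by
  have hR0 : 0 ≤ R := zero_le_one.trans hR
  intro n
  induction n using Nat.strong_induction_on with
  | _ n ih =>
  intro L hL
  rcases List.eq_nil_or_concat L with rfl | ⟨L', i, rfl⟩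
  · simp only [List.length_nil] at hL
    subst hL
    simp [listPderiv]
  · obtain ⟨m, rfl⟩ : ∃ m, n = m + 1 := ⟨L'.length, by simpa using hL.symm⟩
    have hL' : L'.length = m := by simpa using hL
    have e : listPderiv (L' ++ [i]) f = listPderiv L' (pderiv i f) := by
      simp [listPderiv]
    obtain ⟨T, hT, hlen, hTe⟩ := listPderiv_affine_mul (a i) (Q i) hf L'
    rw [List.concat_eq_append, e, hd i, hTe]
    have hq : √(m : ℝ) ≤ √((m + 1 : ℕ) : ℝ) := Real.sqrt_le_sqrt (by push_cast; linarith)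
    set q : ℝ := √((m + 1 : ℕ) : ℝ) with hq_def
    have hq0 : 0 ≤ q := Real.sqrt_nonneg _
    have b1 : ‖(a i + ∑ j, Q i j * (y j : ℂ)) * listPderiv L' f y‖
        ≤ R * s * ((2 * R) ^ m * (s + q) ^ m * ‖f y‖) := by
      rw [norm_mul]
      refine mul_le_mul (hl i) ((ih m (by omega) L' hL').trans ?_) (norm_nonneg _) (by positivity)
      gcongr
    have b2 : ‖(T.map fun p => Q i p.1 * listPderiv p.2 f y).sum‖
        ≤ R * q * ((2 * R) ^ m * (s + q) ^ m * ‖f y‖) := by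
      rcases m with _ | m
      · have : T = [] := List.length_eq_zero_iff.1 (hT.trans hL')
        subst this
        simp only [List.map_nil, List.sum_nil, norm_zero]
        positivity
      · set D : ℝ := R * ((2 * R) ^ (m + 1) * (s + q) ^ m * ‖f y‖) with hD
        have hterm : ∀ p ∈ T, ‖Q i p.1 * listPderiv p.2 f y‖ ≤ D := by
          intro p hp
          have h := ih m (by omega) p.2 (by have := hlen p hp; omega)
          rw [norm_mul]
          refine mul_le_mul (hQ i p.1) (h.trans ?_) (norm_nonneg _) hR0
          have : √(m : ℝ) ≤ q := Real.sqrt_le_sqrt (by push_cast; linarith)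
          gcongr
          · linarith
          · omega
        have hsum : ‖(T.map fun p => Q i p.1 * listPderiv p.2 f y).sum‖ ≤ T.length * D := by
          have : ∀ U : List (Fin d × List (Fin d)),
              (∀ p ∈ U, ‖Q i p.1 * listPderiv p.2 f y‖ ≤ D) →
              ‖(U.map fun p => Q i p.1 * listPderiv p.2 f y).sum‖ ≤ U.length * D := by
            intro U
            induction U with
            | nil => simp
            | cons p U ihU =>
              intro hU
              have h1 := hU p (by simp)
              have h2 := ihU fun p' hp' => hU p' (by simp [hp'])
              simp only [List.map_cons, List.sum_cons, List.length_cons, Nat.cast_add,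
                Nat.cast_one]
              refine (norm_add_le _ _).trans ?_
              rw [add_mul, one_mul, add_comm]
              exact add_le_add h2 h1
          exact this T hterm
        refine hsum.trans ?_
        rw [hT, hL', hD]
        have hm : ((m + 1 : ℕ) : ℝ) ≤ q * (s + q) := by
          have : ((m + 1 : ℕ) : ℝ) ≤ q * q := by
            rw [hq_def, Real.mul_self_sqrt (Nat.cast_nonneg _)]
            push_cast; linarith
          nlinarith [mul_nonneg hq0 hs]
        calc ((m + 1 : ℕ) : ℝ) * (R * ((2 * R) ^ (m + 1) * (s + q) ^ m * ‖f y‖))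
            ≤ (q * (s + q)) * (R * ((2 * R) ^ (m + 1) * (s + q) ^ m * ‖f y‖)) := by gcongr
          _ = _ := by ring
    refine (norm_add_le _ _).trans ((add_le_add b1 b2).trans ?_)
    calc R * s * ((2 * R) ^ m * (s + q) ^ m * ‖f y‖)
          + R * q * ((2 * R) ^ m * (s + q) ^ m * ‖f y‖)
        = R * ((2 * R) ^ m * (s + q) ^ (m + 1) * ‖f y‖) := by ring
      _ ≤ (2 * R) * ((2 * R) ^ m * (s + q) ^ (m + 1) * ‖f y‖) := by
          gcongr; linarith
      _ = _ := by ring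

/-- `r^k ≤ C^k k!^θ e^{δ r^{1/θ}}`. -/
theorem exists_pow_le_exp {θ δ : ℝ} (hθ : 0 < θ) (hδ : 0 < δ) :
    ∃ C > 0, ∀ r : ℝ, 0 ≤ r → ∀ k : ℕ,
      r ^ k ≤ C ^ k * (k.factorial : ℝ) ^ θ * Real.exp (δ * r ^ (1 / θ)) := by
  refine ⟨((δ / θ) ^ θ)⁻¹, by positivity, fun r hr k => ?_⟩
  have hk : (0 : ℝ) < k.factorial := by exact_mod_cast Nat.factorial_pos k
  have h1 : (δ / θ * r ^ (1 / θ)) ^ k / k.factorial ≤ Real.exp (δ / θ * r ^ (1 / θ)) :=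
    Real.pow_div_factorial_le_exp _ (by positivity) k
  rw [div_le_iff₀ hk] at h1
  have h2 := Real.rpow_le_rpow (by positivity) h1 hθ.le
  have e1 : ((δ / θ * r ^ (1 / θ)) ^ k) ^ θ = ((δ / θ) ^ θ) ^ k * r ^ k := by
    rw [← Real.rpow_natCast, ← Real.rpow_mul (by positivity), mul_comm (k : ℝ) θ,
      Real.rpow_mul (by positivity), Real.mul_rpow (by positivity) (by positivity),
      ← Real.rpow_mul hr, one_div, inv_mul_cancel₀ hθ.ne', Real.rpow_one, Real.rpow_natCast,
      mul_pow]
  have e2 : Real.exp (δ / θ * r ^ (1 / θ)) ^ θ = Real.exp (δ * r ^ (1 / θ)) := by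
    rw [← Real.exp_mul]
    congr 1
    field_simp
  rw [e1, Real.mul_rpow (by positivity) hk.le, e2] at h2
  rw [inv_pow, mul_assoc, inv_mul_eq_div, le_div_iff₀ (by positivity)]
  linarith

theorem factorial_add_rpow_le {θ : ℝ} (hθ₀ : 0 ≤ θ) (hθ : θ ≤ 1) (k n : ℕ) :
    ((k + n).factorial : ℝ) ^ θ
      ≤ 2 ^ (k + n) * ((k.factorial : ℝ) ^ θ * (n.factorial : ℝ) ^ θ) := by
  have h1 : ((k + n).factorial : ℝ) ≤ 2 ^ (k + n) * (k.factorial * n.factorial) := by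
    rw [← Nat.add_choose_mul_factorial_mul_factorial]
    push_cast
    rw [mul_assoc]
    gcongr
    exact_mod_cast Nat.choose_le_two_pow _ _
  refine (Real.rpow_le_rpow (by positivity) h1 hθ₀).trans ?_
  rw [Real.mul_rpow (by positivity) (by positivity), Real.mul_rpow (by positivity) (by positivity)]
  gcongr
  calc ((2 : ℝ) ^ (k + n)) ^ θ ≤ ((2 : ℝ) ^ (k + n)) ^ (1 : ℝ) :=
        Real.rpow_le_rpow_of_exponent_le (one_le_pow₀ (by norm_num)) hθ
    _ = _ := Real.rpow_one _

theorem factorial_rpow_le_mfact {d : ℕ} {θ : ℝ} (hθ₀ : 0 ≤ θ) (hθ : θ ≤ 1) (α : Fin d → ℕ) :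
    ((mlen α).factorial : ℝ) ^ θ ≤ ((d : ℝ) + 1) ^ mlen α * (mfact α : ℝ) ^ θ := by
  refine (Real.rpow_le_rpow (by positivity) (mlen_factorial_le α) hθ₀).trans ?_
  rw [Real.mul_rpow (by positivity) (by positivity)]
  gcongr
  have h : (1 : ℝ) ≤ ((d : ℝ) + 1) ^ mlen α :=
    one_le_pow₀ (by linarith [Nat.cast_nonneg (α := ℝ) d])
  simpa using Real.rpow_le_rpow_of_exponent_le h hθ

theorem sqrt_factorial_le_rpow {θ : ℝ} (hθ : 1 / 2 ≤ θ) (n : ℕ) :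
    √(n.factorial : ℝ) ≤ (n.factorial : ℝ) ^ θ := by
  rw [Real.sqrt_eq_rpow]
  refine Real.rpow_le_rpow_of_exponent_le ?_ hθ
  exact_mod_cast Nat.factorial_pos n

theorem sqrt_pow_self_le {θ : ℝ} (hθ : 1 / 2 ≤ θ) (n : ℕ) :
    √(n : ℝ) ^ n ≤ 2 ^ n * (n.factorial : ℝ) ^ θ := by
  have hn : (0 : ℝ) < n.factorial := by exact_mod_cast Nat.factorial_pos n
  have h1 : (n : ℝ) ^ n ≤ 4 ^ n * n.factorial := by
    have h := Real.pow_div_factorial_le_exp (n : ℝ) (Nat.cast_nonneg n) n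
    rw [div_le_iff₀ hn] at h
    refine h.trans ?_
    gcongr
    rw [← Real.exp_one_pow]
    gcongr
    linarith [Real.exp_one_lt_d9]
  refine le_trans ?_ (mul_le_mul_of_nonneg_left (sqrt_factorial_le_rpow hθ n) (by positivity))
  refine le_of_sq_le_sq ?_ (by positivity)
  rw [← pow_mul, mul_comm n 2, pow_mul, Real.sq_sqrt (Nat.cast_nonneg _), mul_pow,
    Real.sq_sqrt hn.le, ← pow_mul, mul_comm n 2, pow_mul]
  norm_num
  exact h1

namespace FBIPhase

theorem norm_packet {d : ℕ} (φ : FBIPhase d) (z : CSpace d) (y : RSpace d) :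
    ‖φ.packet z y‖ = Real.exp (-(φ.form z y).im) := by
  simp [packet, Complex.norm_exp]

theorem bddAbove_weight {d : ℕ} (φ : FBIPhase d) (z : CSpace d) :
    BddAbove (Set.range fun y : RSpace d => -(φ.form z y).im) := by
  obtain ⟨c, hc, M, h⟩ := packet_bound φ z
  refine ⟨M, ?_⟩
  rintro _ ⟨y, rfl⟩
  have hM : 0 ≤ M := by
    have := (norm_nonneg _).trans (h 0)
    simpa using this
  have h1 := h y
  rw [norm_packet] at h1
  have h2 : Real.exp (-c * ‖y‖ ^ 2) ≤ 1 := Real.exp_le_one_iff.2 (by nlinarith [sq_nonneg ‖y‖])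
  have h3 := Real.add_one_le_exp (-(φ.form z y).im)
  have h4 := mul_le_mul_of_nonneg_left h2 hM
  change -(φ.form z y).im ≤ M
  linarith

theorem le_weight {d : ℕ} (φ : FBIPhase d) (z : CSpace d) (y : RSpace d) :
    -(φ.form z y).im ≤ φ.weight z :=
  le_ciSup (φ.bddAbove_weight z) y

theorem exists_norm_mulVec_le {d : ℕ} (B : Matrix (Fin d) (Fin d) ℂ) :
    ∃ b ≥ 0, ∀ (z : CSpace d) (i : Fin d), ‖(B *ᵥ z.ofLp) i‖ ≤ b * ‖z‖ := by
  refine ⟨∑ i, ∑ j, ‖B i j‖, by positivity, fun z i => ?_⟩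
  rw [Matrix.mulVec, dotProduct]
  refine (norm_sum_le _ _).trans ?_
  calc ∑ j, ‖B i j * z.ofLp j‖ ≤ ∑ j, ‖B i j‖ * ‖z‖ := by
        refine Finset.sum_le_sum fun j _ => ?_
        rw [norm_mul]
        gcongr
        exact PiLp.norm_apply_le z j
    _ = (∑ j, ‖B i j‖) * ‖z‖ := by rw [Finset.sum_mul]
    _ ≤ _ := mul_le_mul_of_nonneg_right
        (Finset.single_le_sum (f := fun i => ∑ j, ‖B i j‖) (fun _ _ => by positivity)
          (Finset.mem_univ i)) (norm_nonneg _)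

theorem exists_form_le {d : ℕ} (φ : FBIPhase d) :
    ∃ c > 0, ∃ b ≥ 0, ∀ (z : CSpace d) (y : RSpace d),
      -(φ.form z y).im ≤ φ.weight z + b * ‖z‖ * ‖y‖ - c * ‖y‖ ^ 2 := by
  obtain ⟨c, hc, hcoer⟩ := exists_coercive φ.posC
  obtain ⟨b, hb, hB⟩ := exists_norm_mulVec_le φ.B
  refine ⟨c / 2, by positivity, d * b, by positivity, fun z y => ?_⟩
  have h0 := φ.le_weight z 0
  have e0 : φ.form z 0 = (1 / 2) * ((φ.A *ᵥ z.ofLp) ⬝ᵥ z.ofLp) := by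
    have : toC (0 : RSpace d) = 0 := by
      funext i; simp [toC]
    simp [form, this]
  have h1 : -((φ.B *ᵥ z.ofLp) ⬝ᵥ toC y).im ≤ d * b * ‖z‖ * ‖y‖ := by
    refine (neg_le_abs _).trans ((Complex.abs_im_le_norm _).trans ?_)
    rw [dotProduct]
    refine (norm_sum_le _ _).trans ?_
    calc ∑ i, ‖(φ.B *ᵥ z.ofLp) i * toC y i‖ ≤ ∑ _i : Fin d, b * ‖z‖ * ‖y‖ := by
          refine Finset.sum_le_sum fun i _ => ?_
          rw [norm_mul, toC, Complex.norm_real]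
          have := hB z i
          gcongr
          exact PiLp.norm_apply_le y i
      _ = _ := by simp; ring
  have h2 : ((1 / 2) * ((φ.C *ᵥ toC y) ⬝ᵥ toC y)).im
      = (1 / 2) * (((φ.C.map Complex.im) *ᵥ y.ofLp) ⬝ᵥ y.ofLp) := by
    have e : ((φ.C *ᵥ toC y) ⬝ᵥ toC y).im = ((φ.C.map Complex.im) *ᵥ y.ofLp) ⬝ᵥ y.ofLp := by
      simp [dotProduct, Matrix.mulVec, toC, Finset.sum_mul, Complex.im_sum]
    rw [← e]
    simp [Complex.mul_im]
  have h3 := hcoer y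
  rw [e0] at h0
  unfold form
  rw [Complex.add_im, Complex.add_im, h2]
  linarith

/-- `(|z| + |y|)^k |e^{iφ(z, y)}| ≤ K^k k!^θ e^{δ|z|^{1/θ} + Φ(z)}`. -/
theorem exists_pow_mul_packet_le {d : ℕ} {θ δ : ℝ} (hθ : 1 / 2 ≤ θ) (hδ : 0 < δ)
    (φ : FBIPhase d) :
    ∃ K > 0, ∀ (z : CSpace d) (y : RSpace d) (k : ℕ),
      (‖z‖ + ‖y‖) ^ k * ‖φ.packet z y‖
        ≤ K ^ k * (k.factorial : ℝ) ^ θ * Real.exp (δ * ‖z‖ ^ (1 / θ) + φ.weight z) := by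
  have hθ0 : 0 < θ := by linarith
  obtain ⟨C, hC, hpow⟩ := exists_pow_le_exp hθ0 hδ
  obtain ⟨c, hc, b, hb, hform⟩ := exists_form_le φ
  set ρ : ℝ := 2 * b / c with hρ
  have hρ0 : 0 ≤ ρ := by positivity
  set G : ℝ := (√(c / 2))⁻¹ with hG
  have hG0 : 0 ≤ G := by positivity
  refine ⟨(1 + ρ) * C + 2 * (C + G), by positivity, fun z y k => ?_⟩
  set r : ℝ := ‖z‖ with hr
  have hr0 : 0 ≤ r := norm_nonneg _
  set E : ℝ := Real.exp (δ * r ^ (1 / θ)) with hE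
  have hE1 : 1 ≤ E := Real.one_le_exp (by positivity)
  have hE0 : 0 ≤ E := zero_le_one.trans hE1
  set W : ℝ := Real.exp (φ.weight z) with hW
  have hW0 : 0 ≤ W := (Real.exp_pos _).le
  set N : ℝ := (k.factorial : ℝ) ^ θ with hN
  have hN0 : 0 ≤ N := by positivity
  have hp : ‖φ.packet z y‖ ≤ W := by
    rw [norm_packet]; exact Real.exp_le_exp.2 (φ.le_weight z y)
  rw [Real.exp_add, ← hE, ← hW]
  by_cases hy : ‖y‖ ≤ ρ * r
  · calc (r + ‖y‖) ^ k * ‖φ.packet z y‖ ≤ ((1 + ρ) * r) ^ k * W := by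
          gcongr; linarith
      _ = (1 + ρ) ^ k * r ^ k * W := by rw [mul_pow]
      _ ≤ (1 + ρ) ^ k * (C ^ k * N * E) * W := by gcongr; exact hpow r hr0 k
      _ = ((1 + ρ) * C) ^ k * N * (E * W) := by rw [mul_pow]; ring
      _ ≤ _ := by gcongr; linarith
  · push Not at hy
    have hg : ‖φ.packet z y‖ ≤ W * Real.exp (-(c / 2) * ‖y‖ ^ 2) := by
      rw [norm_packet, hW, ← Real.exp_add]
      refine Real.exp_le_exp.2 ((hform z y).trans ?_)
      have h1 : b * r ≤ c / 2 * ‖y‖ := by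
        have : c / 2 * (ρ * r) = b * r := by rw [hρ]; field_simp
        rw [← this]; gcongr
      nlinarith [mul_le_mul_of_nonneg_right h1 (norm_nonneg y)]
    have hgk := pow_mul_gauss_le (half_pos hc) k (norm_nonneg y)
    have h1 : ‖y‖ ^ k * ‖φ.packet z y‖ ≤ G ^ k * N * (E * W) := by
      calc ‖y‖ ^ k * ‖φ.packet z y‖ ≤ ‖y‖ ^ k * (W * Real.exp (-(c / 2) * ‖y‖ ^ 2)) := by gcongr
        _ = (‖y‖ ^ k * Real.exp (-(c / 2) * ‖y‖ ^ 2)) * W := by ring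
        _ ≤ (G ^ k * √(k.factorial : ℝ)) * W := by gcongr
        _ ≤ (G ^ k * N) * W := by gcongr; exact sqrt_factorial_le_rpow hθ k
        _ = (G ^ k * N) * (1 * W) := by ring
        _ ≤ _ := by gcongr
    have h2 : r ^ k * ‖φ.packet z y‖ ≤ C ^ k * N * (E * W) := by
      calc r ^ k * ‖φ.packet z y‖ ≤ (C ^ k * N * E) * W := by gcongr; exact hpow r hr0 k
        _ = _ := by ring
    have h3 : (r + ‖y‖) ^ k ≤ 2 ^ k * (r ^ k + ‖y‖ ^ k) := by
      refine (add_pow_le hr0 (norm_nonneg y) k).trans ?_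
      gcongr
      · norm_num
      · omega
    have h5 : C ^ k + G ^ k ≤ 1 * (C + G) ^ k ∨ k = 0 := by
      rcases Nat.eq_zero_or_pos k with h | h
      · exact Or.inr h
      · left
        rw [one_mul]
        exact pow_add_pow_le hC.le hG0 h.ne'
    rcases h5 with h5 | rfl
    · calc (r + ‖y‖) ^ k * ‖φ.packet z y‖
          ≤ 2 ^ k * (r ^ k + ‖y‖ ^ k) * ‖φ.packet z y‖ := by gcongr
        _ = 2 ^ k * (r ^ k * ‖φ.packet z y‖ + ‖y‖ ^ k * ‖φ.packet z y‖) := by ring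
        _ ≤ 2 ^ k * (C ^ k * N * (E * W) + G ^ k * N * (E * W)) := by gcongr
        _ = 2 ^ k * (C ^ k + G ^ k) * N * (E * W) := by ring
        _ ≤ 2 ^ k * (1 * (C + G) ^ k) * N * (E * W) := by gcongr
        _ = (2 * (C + G)) ^ k * N * (E * W) := by rw [mul_pow]; ring
        _ ≤ _ := by
          gcongr
          have : 0 ≤ (1 + ρ) * C := by positivity
          linarith
    · simp only [hN, pow_zero, one_mul, Nat.factorial_zero, Nat.cast_one, Real.one_rpow]
      nlinarith

theorem exists_packet_GSBound {d : ℕ} {θ δ : ℝ} (hθ : 1 / 2 ≤ θ) (hθ' : θ ≤ 1) (hδ : 0 < δ)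
    (φ : FBIPhase d) :
    ∃ C > 0, ∀ z : CSpace d,
      GSBound θ C (2 * Real.exp (δ * ‖z‖ ^ (1 / θ) + φ.weight z)) (φ.packet z) := by
  have hθ0 : 0 ≤ θ := by linarith
  obtain ⟨K, hK, hpow⟩ := exists_pow_mul_packet_le hθ hδ φ
  obtain ⟨b, hb, hB⟩ := exists_norm_mulVec_le φ.B
  set R : ℝ := 1 + b + ∑ i, ∑ j, ‖φ.C i j‖ with hR
  have hCs : 0 ≤ ∑ i, ∑ j, ‖φ.C i j‖ := by positivity
  have hR1 : 1 ≤ R := by linarith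
  have hCi : ∀ i, ∑ j, ‖φ.C i j‖ ≤ R := fun i =>
    (Finset.single_le_sum (f := fun i => ∑ j, ‖φ.C i j‖) (fun _ _ => by positivity)
      (Finset.mem_univ i)).trans (by linarith)
  have hCij : ∀ i j, ‖Complex.I * φ.C i j‖ ≤ R := fun i j => by
    rw [norm_mul, Complex.norm_I, one_mul]
    exact (Finset.single_le_sum (f := fun j => ‖φ.C i j‖) (fun _ _ => norm_nonneg _)
      (Finset.mem_univ j)).trans (hCi i)
  have hl : ∀ (z : CSpace d) (y : RSpace d) (i : Fin d),
      ‖Complex.I * (φ.B *ᵥ z.ofLp) i + ∑ j, Complex.I * φ.C i j * (y j : ℂ)‖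
        ≤ R * (‖z‖ + ‖y‖) := by
    intro z y i
    refine (norm_add_le _ _).trans ?_
    rw [mul_add]
    refine add_le_add ?_ ?_
    · rw [norm_mul, Complex.norm_I, one_mul]
      refine (hB z i).trans ?_
      gcongr
      linarith
    · refine (norm_sum_le _ _).trans ?_
      calc ∑ j, ‖Complex.I * φ.C i j * (y j : ℂ)‖ ≤ ∑ j, ‖φ.C i j‖ * ‖y‖ := by
            refine Finset.sum_le_sum fun j _ => ?_
            rw [norm_mul, norm_mul, Complex.norm_I, one_mul, Complex.norm_real]
            gcongr
            exact PiLp.norm_apply_le y j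
        _ = (∑ j, ‖φ.C i j‖) * ‖y‖ := by rw [Finset.sum_mul]
        _ ≤ R * ‖y‖ := by gcongr; exact hCi i
  refine ⟨4 * R * ((K + 1) * 2) * ((d : ℝ) + 1), by positivity, fun z α β y => ?_⟩
  set s : ℝ := ‖z‖ + ‖y‖ with hs
  have hs0 : 0 ≤ s := by positivity
  set W : ℝ := Real.exp (δ * ‖z‖ ^ (1 / θ) + φ.weight z) with hW
  have hW0 : 0 ≤ W := (Real.exp_pos _).le
  set k := mlen α with hk
  set n := mlen β with hn
  set P : ℝ := ‖φ.packet z y‖ with hP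
  have hP0 : 0 ≤ P := norm_nonneg _
  set a : ℝ := (k.factorial : ℝ) ^ θ with ha
  set c : ℝ := (n.factorial : ℝ) ^ θ with hc
  have ha0 : 0 ≤ a := by positivity
  have hc0 : 0 ≤ c := by positivity
  have hder : ‖iterPderiv β (φ.packet z) y‖ ≤ (2 * R) ^ n * (s + √n) ^ n * P := by
    rw [iterPderiv_eq]
    exact norm_listPderiv_le_of_affine (contDiff_packet φ z) _ _ (pderiv_packet φ z) hR1 hs0 y
      hCij (hl z y) n _ (length_dirs β)
  have hmon : |∏ i, y i ^ α i| ≤ s ^ k :=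
    (abs_monomial_le α y).trans (by gcongr; rw [hs]; linarith [norm_nonneg z])
  have h1 : s ^ k * P ≤ K ^ k * a * W := hpow z y k
  have h2 : s ^ (k + n) * P ≤ K ^ (k + n) * (2 ^ (k + n) * (a * c)) * W :=
    (hpow z y (k + n)).trans (by gcongr; exact factorial_add_rpow_le hθ0 hθ' k n)
  have h3 : (s + √n) ^ n ≤ 2 ^ n * (s ^ n + 2 ^ n * c) := by
    refine (add_pow_le hs0 (Real.sqrt_nonneg _) n).trans ?_
    gcongr
    · norm_num
    · omega
    · exact sqrt_pow_self_le hθ n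
  have hfa : a ≤ ((d : ℝ) + 1) ^ k * (mfact α : ℝ) ^ θ := factorial_rpow_le_mfact hθ0 hθ' α
  have hfc : c ≤ ((d : ℝ) + 1) ^ n * (mfact β : ℝ) ^ θ := factorial_rpow_le_mfact hθ0 hθ' β
  calc |∏ i, y i ^ α i| * ‖iterPderiv β (φ.packet z) y‖
      ≤ s ^ k * ((2 * R) ^ n * (s + √n) ^ n * P) := by gcongr
    _ ≤ s ^ k * ((2 * R) ^ n * (2 ^ n * (s ^ n + 2 ^ n * c)) * P) := by gcongr
    _ = (4 * R) ^ n * (s ^ (k + n) * P + 2 ^ n * c * (s ^ k * P)) := by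
        rw [show (4 : ℝ) * R = 2 * R * 2 by ring, mul_pow (2 * R) 2, pow_add]; ring
    _ ≤ (4 * R) ^ n * (K ^ (k + n) * (2 ^ (k + n) * (a * c)) * W
          + 2 ^ n * c * (K ^ k * a * W)) := by gcongr
    _ ≤ (4 * R) ^ n * ((K + 1) ^ (k + n) * (2 ^ (k + n) * (a * c)) * W
          + 2 ^ (k + n) * c * ((K + 1) ^ (k + n) * a * W)) := by
        gcongr
        · linarith
        · norm_num
        · omega
        · calc K ^ k ≤ (K + 1) ^ k := by gcongr; linarith
            _ ≤ _ := pow_le_pow_right₀ (by linarith) (by omega)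
    _ = (4 * R) ^ n * 2 * ((K + 1) * 2) ^ (k + n) * (a * c) * W := by
        rw [mul_pow (K + 1)]; ring
    _ ≤ (4 * R) ^ (k + n) * 2 * ((K + 1) * 2) ^ (k + n)
          * ((((d : ℝ) + 1) ^ k * (mfact α : ℝ) ^ θ) * (((d : ℝ) + 1) ^ n * (mfact β : ℝ) ^ θ))
          * W := by
        gcongr
        · linarith
        · omega
    _ = _ := by
        rw [mul_pow (4 * R * ((K + 1) * 2)), mul_pow (4 * R) ((K + 1) * 2),
          pow_add ((d : ℝ) + 1)]
        ring

end FBIPhase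

/-! ### Taylor's formula -/

theorem clm_apply_eq_sum {d : ℕ} (T : RSpace d →L[ℝ] ℂ) (h : RSpace d) :
    T h = ∑ i, (h i : ℂ) * T (EuclideanSpace.single i 1) := by
  have e : h = ∑ i, h i • EuclideanSpace.single i (1 : ℝ) := by
    ext k
    simp [Pi.single_apply]
  conv_lhs => rw [e, map_sum]
  simp

theorem norm_clm_le {d : ℕ} {T : RSpace d →L[ℝ] ℂ} {B : ℝ} (hB : 0 ≤ B)
    (h : ∀ i, ‖T (EuclideanSpace.single i 1)‖ ≤ B) : ‖T‖ ≤ d * B := by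
  refine T.opNorm_le_bound (by positivity) fun x => ?_
  rw [clm_apply_eq_sum]
  refine (norm_sum_le _ _).trans ?_
  calc ∑ i, ‖(x i : ℂ) * T (EuclideanSpace.single i 1)‖ ≤ ∑ _i : Fin d, ‖x‖ * B := by
        refine Finset.sum_le_sum fun i _ => ?_
        rw [norm_mul, Complex.norm_real]
        exact mul_le_mul (PiLp.norm_apply_le x i) (h i) (norm_nonneg _) (norm_nonneg _)
    _ = _ := by simp; ring

theorem norm_taylor_le {d : ℕ} {f : RSpace d → ℂ} (hf : ContDiff ℝ ∞ f) {B : ℝ} (hB : 0 ≤ B)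
    (h2 : ∀ i j x, ‖pderiv i (pderiv j f) x‖ ≤ B) (x h : RSpace d) :
    ‖f (x + h) - f x - ∑ i, (h i : ℂ) * pderiv i f x‖ ≤ d ^ 2 * B * ‖h‖ ^ 2 := by
  have hdf : ∀ g : RSpace d → ℂ, ContDiff ℝ ∞ g → ∀ i x,
      fderiv ℝ g x (EuclideanSpace.single i 1) = pderiv i g x := fun _ _ _ _ => rfl
  have hlip : ∀ j x', ‖pderiv j f x' - pderiv j f x‖ ≤ d * B * ‖x' - x‖ := fun j x' =>
    convex_univ.norm_image_sub_le_of_norm_fderiv_le (𝕜 := ℝ)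
      (fun y _ => smooth_differentiableAt (contDiff_pderiv j hf) y)
      (fun y _ => norm_clm_le hB fun i => h2 i j y) (Set.mem_univ _) (Set.mem_univ _)
  have h3 : ∀ x' ∈ Metric.closedBall x ‖h‖,
      ‖fderiv ℝ f x' - fderiv ℝ f x‖ ≤ d * (d * B * ‖h‖) := by
    intro x' hx'
    refine norm_clm_le (by positivity) fun j => (hlip j x').trans ?_
    gcongr
    simpa [dist_eq_norm] using hx'
  have h4 := (convex_closedBall x ‖h‖).norm_image_sub_le_of_norm_fderiv_le' (𝕜 := ℝ)
    (fun y _ => smooth_differentiableAt hf y) h3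
    (Metric.mem_closedBall_self (norm_nonneg h)) (y := x + h) (by simp)
  rw [add_sub_cancel_left, clm_apply_eq_sum] at h4
  exact h4.trans (le_of_eq (by ring))

theorem mul_norm_taylor_le {d : ℕ} {f : RSpace d → ℂ} (hf : ContDiff ℝ ∞ f) {m B : ℝ}
    (hm : 0 ≤ m) (hB : 0 ≤ B) (h2 : ∀ i j x, m * ‖pderiv i (pderiv j f) x‖ ≤ B)
    (x h : RSpace d) :
    m * ‖f (x + h) - f x - ∑ i, (h i : ℂ) * pderiv i f x‖ ≤ d ^ 2 * B * ‖h‖ ^ 2 := by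
  rcases hm.eq_or_lt with rfl | hm
  · rw [zero_mul]; positivity
  · have := norm_taylor_le hf (B := B / m) (by positivity)
      (fun i j x => (le_div_iff₀' hm).2 (h2 i j x)) x h
    calc _ ≤ m * (d ^ 2 * (B / m) * ‖h‖ ^ 2) := by gcongr
      _ = _ := by field_simp

/-! ### Partial evaluation of an ultradistribution -/

/-- The slice `F(x, ·)` as a test function. -/
noncomputable def sliceGS {θ : ℝ} {d₁ d₂ : ℕ} (F : GS θ (d₁ + d₂)) (x : RSpace d₁) : GS θ d₂ :=
  ⟨slice F x, by
    obtain ⟨hs, C, hC, M, hM⟩ := F.2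
    exact ⟨contDiff_slice hs x, C, hC, M, hM.slice_zero hs x⟩⟩

/-- The partial derivative of a test function as a test function. -/
noncomputable def pderivGS {θ : ℝ} (hθ : θ ≤ 1) {d : ℕ} (i : Fin d) : GS θ d →ₗ[ℂ] GS θ d where
  toFun f := ⟨pderiv i f, pderiv_mem_GS hθ f.2 i⟩
  map_add' f g := Subtype.ext (pderiv_add i f.2.1 g.2.1)
  map_smul' c f := Subtype.ext (pderiv_smul i c f.2.1)

theorem exists_listPderivGS {θ : ℝ} (hθ : θ ≤ 1) {d : ℕ} (L : List (Fin d)) :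
    ∃ T : GS θ d →ₗ[ℂ] GS θ d, ∀ f : GS θ d, (T f : RSpace d → ℂ) = listPderiv L f := by
  induction L with
  | nil => exact ⟨LinearMap.id, fun _ => rfl⟩
  | cons i L ih =>
    obtain ⟨T, hT⟩ := ih
    exact ⟨pderivGS hθ i ∘ₗ T, fun f => congrArg (pderiv i) (hT f)⟩

/-- The function `x ↦ ⟨v, F(x, ·)⟩`. -/
noncomputable def partialEval {θ : ℝ} {d₁ d₂ : ℕ} (v : GSDual θ d₂) (F : GS θ (d₁ + d₂)) :
    RSpace d₁ → ℂ := fun x => v.eval (sliceGS F x)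

/-- The first order Taylor remainder of `x ↦ F(x, ·)`. -/
noncomputable def sliceRem {θ : ℝ} (hθ : θ ≤ 1) {d₁ d₂ : ℕ} (F : GS θ (d₁ + d₂))
    (x h : RSpace d₁) : GS θ d₂ :=
  sliceGS F (x + h) - sliceGS F x
    - ∑ i, (h i : ℂ) • sliceGS (pderivGS hθ (Fin.castAdd d₂ i) F) x

theorem sliceRem_GSBound {θ : ℝ} (hθ : θ ≤ 1) {d₁ d₂ : ℕ} {C M : ℝ} (hC : 0 < C)
    (F : GS θ (d₁ + d₂)) (hF : GSBound θ C M (F : RSpace (d₁ + d₂) → ℂ)) (x h : RSpace d₁) :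
    GSBound θ (2 * (2 * C)) (d₁ ^ 2 * (2 * C * (C * M)) * ‖h‖ ^ 2)
      (sliceRem hθ F x h : RSpace d₂ → ℂ) := by
  intro α β y
  have hs := F.2.1
  have hM := hF.nonneg
  set L := (dirs β).map (Fin.natAdd d₁) with hL
  set f : RSpace d₁ → ℂ := coslice (listPderiv L F) y with hf
  have hLs := contDiff_listPderiv L hs
  have hcomm : ∀ (k : Fin (d₁ + d₂)) (G : RSpace (d₁ + d₂) → ℂ), ContDiff ℝ ∞ G →
      pderiv k (listPderiv L G) = listPderiv L (pderiv k G) := by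
    intro k G hG
    have := listPderiv_perm (List.perm_append_singleton k L).symm hG
    rw [listPderiv_append] at this
    exact this
  have h1 : ∀ i x', pderiv i f x'
      = listPderiv L (pderiv (Fin.castAdd d₂ i) F) (join x' y) := by
    intro i x'
    rw [hf, pderiv_coslice hLs, hcomm _ _ hs]
    rfl
  have h2 : ∀ i j x', pderiv i (pderiv j f) x'
      = iterPderiv β (slice (pderiv (Fin.castAdd d₂ i) (pderiv (Fin.castAdd d₂ j) F)) x') y := by
    intro i j x'
    rw [hf, pderiv_coslice hLs, pderiv_coslice (contDiff_pderiv _ hLs), hcomm _ _ hs,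
      hcomm _ _ (contDiff_pderiv _ hs), iterPderiv_eq,
      listPderiv_slice (contDiff_pderiv _ (contDiff_pderiv _ hs))]
    rfl
  have hrem : iterPderiv β (sliceRem hθ F x h : RSpace d₂ → ℂ) y
      = f (x + h) - f x - ∑ i, (h i : ℂ) * pderiv i f x := by
    obtain ⟨T, hT⟩ := exists_listPderivGS (θ := θ) hθ (dirs β)
    have hsl : ∀ (G : GS θ (d₁ + d₂)) (x' : RSpace d₁),
        (T (sliceGS G x') : RSpace d₂ → ℂ) y = listPderiv L G (join x' y) := by
      intro G x'
      rw [hT]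
      exact congrFun (listPderiv_slice G.2.1 x' (dirs β)) y
    rw [iterPderiv_eq, ← hT, sliceRem, map_sub, map_sub, map_sum]
    simp only [map_smul, Submodule.coe_sub, Submodule.coe_sum, Submodule.coe_smul, Pi.sub_apply,
      Finset.sum_apply, Pi.smul_apply, smul_eq_mul, hsl, h1]
    rfl
  rw [hrem]
  refine (mul_norm_taylor_le (contDiff_coslice hLs y) (abs_nonneg _) (B := 2 * C * (C * M) *
    ((2 * (2 * C)) ^ (mlen α + mlen β) * ((mfact α : ℝ) ^ θ * (mfact β : ℝ) ^ θ)))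
    (by positivity) (fun i j x' => ?_) x h).trans (le_of_eq (by ring))
  rw [h2]
  have hb := (hF.pderiv hθ hC hs (Fin.castAdd d₂ j)).pderiv hθ (by positivity)
    (contDiff_pderiv _ hs) (Fin.castAdd d₂ i)
  exact hb.slice_zero (contDiff_pderiv _ (contDiff_pderiv _ hs)) x' α β y

theorem hasFDerivAt_partialEval {θ : ℝ} (hθ : θ ≤ 1) {d₁ d₂ : ℕ} (v : GSDual θ d₂)
    (F : GS θ (d₁ + d₂)) (x : RSpace d₁) :
    HasFDerivAt (partialEval v F)
      (∑ i, (EuclideanSpace.proj (𝕜 := ℝ) i : RSpace d₁ →L[ℝ] ℝ).smulRight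
        (partialEval v (pderivGS hθ (Fin.castAdd d₂ i) F) x)) x := by
  obtain ⟨_, C, hC, M, hM⟩ := F.2
  obtain ⟨K, hK⟩ := v.2 (2 * (2 * C)) (by positivity)
  rw [hasFDerivAt_iff_isLittleO_nhds_zero]
  refine Asymptotics.IsBigO.trans_isLittleO (g := fun h : RSpace d₁ => ‖h‖ ^ 2) ?_
    (Asymptotics.isLittleO_norm_pow_id one_lt_two)
  refine Asymptotics.IsBigO.of_bound (K * (d₁ ^ 2 * (2 * C * (C * M))))
    (Filter.Eventually.of_forall fun h => ?_)
  have h1 := hK _ _ (sliceRem_GSBound hθ hC F hM x h)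
  refine le_trans (le_of_eq ?_) (h1.trans (le_of_eq ?_))
  · rw [sliceRem, map_sub, map_sub, map_sum]
    simp [partialEval, GSDual.eval]
  · rw [norm_pow, norm_norm]; ring

theorem contDiff_partialEval {θ : ℝ} (hθ : θ ≤ 1) {d₁ d₂ : ℕ} (v : GSDual θ d₂)
    (F : GS θ (d₁ + d₂)) : ContDiff ℝ ∞ (partialEval v F) := by
  rw [contDiff_infty]
  intro n
  induction n generalizing F with
  | zero =>
    exact contDiff_zero.2 (continuous_iff_continuousAt.2 fun x =>
      (hasFDerivAt_partialEval hθ v F x).continuousAt)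
  | succ n ih =>
    rw [Nat.cast_add, Nat.cast_one, contDiff_succ_iff_hasFDerivAt]
    exact ⟨_, ContDiff.sum fun i _ => contDiff_const.smulRight (ih _),
      hasFDerivAt_partialEval hθ v F⟩

theorem pderiv_partialEval {θ : ℝ} (hθ : θ ≤ 1) {d₁ d₂ : ℕ} (v : GSDual θ d₂)
    (F : GS θ (d₁ + d₂)) (i : Fin d₁) :
    pderiv i (partialEval v F) = partialEval v (pderivGS hθ (Fin.castAdd d₂ i) F) := by
  funext x
  rw [pderiv, (hasFDerivAt_partialEval hθ v F x).fderiv]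
  simp [PiLp.single_apply]

theorem exists_listPderiv_partialEval {θ : ℝ} (hθ : θ ≤ 1) {d₁ d₂ : ℕ} (v : GSDual θ d₂)
    (F : GS θ (d₁ + d₂)) (L : List (Fin d₁)) :
    ∃ G : GS θ (d₁ + d₂), (G : RSpace (d₁ + d₂) → ℂ) = listPderiv (L.map (Fin.castAdd d₂)) F ∧
      listPderiv L (partialEval v F) = partialEval v G := by
  induction L with
  | nil => exact ⟨F, rfl, rfl⟩
  | cons i L ih =>
    obtain ⟨G, hG, hGe⟩ := ih
    refine ⟨pderivGS hθ (Fin.castAdd d₂ i) G, congrArg (pderiv (Fin.castAdd d₂ i)) hG, ?_⟩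
    rw [← pderiv_partialEval, ← hGe]
    rfl

theorem partialEval_GSBound {θ : ℝ} (hθ : θ ≤ 1) {d₁ d₂ : ℕ} {v : GSDual θ d₂} {C K : ℝ}
    (hK : ∀ (f : GS θ d₂) (M : ℝ), GSBound θ C M (f : RSpace d₂ → ℂ) → ‖v.1 f‖ ≤ K * M)
    (F : GS θ (d₁ + d₂)) {M : ℝ} (hF : GSBound θ C M (F : RSpace (d₁ + d₂) → ℂ)) :
    GSBound θ C (K * M) (partialEval v F) := by
  intro a b x
  obtain ⟨G, hG, hGe⟩ := exists_listPderiv_partialEval hθ v F (dirs b)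
  have h := hF.slice F.2.1 a b x
  rw [← hG] at h
  have h1 := hK (((∏ i, x i ^ a i : ℝ) : ℂ) • sliceGS G x) _ h
  rw [iterPderiv_eq, hGe]
  rw [map_smul, norm_smul, Complex.norm_real, Real.norm_eq_abs] at h1
  exact h1.trans (le_of_eq (by ring))

/-! ### Tensor products -/

/-- The map `F ↦ ⟨v, F(x, ·)⟩` from `𝒮_θ(ℝ^{d₁+d₂})` to `𝒮_θ(ℝ^{d₁})`. -/
noncomputable def partialEvalGS {θ : ℝ} (hθ : θ ≤ 1) {d₁ d₂ : ℕ} (v : GSDual θ d₂) :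
    GS θ (d₁ + d₂) →ₗ[ℂ] GS θ d₁ where
  toFun F := ⟨partialEval v F, by
    obtain ⟨_, C, hC, M, hM⟩ := F.2
    obtain ⟨K, hK⟩ := v.2 C hC
    exact ⟨contDiff_partialEval hθ v F, C, hC, K * M, partialEval_GSBound hθ hK F hM⟩⟩
  map_add' F G := Subtype.ext (funext fun x => v.1.map_add (sliceGS F x) (sliceGS G x))
  map_smul' c F := Subtype.ext (funext fun x => v.1.map_smul c (sliceGS F x))

theorem exists_isTensorProduct {θ : ℝ} (hθ : θ ≤ 1) {d₁ d₂ : ℕ} (u : GSDual θ d₁)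
    (v : GSDual θ d₂) : ∃ w : GSDual θ (d₁ + d₂), IsTensorProduct u v w := by
  refine ⟨⟨u.1 ∘ₗ partialEvalGS hθ v, fun ε hε => ?_⟩, fun F =>
    ⟨partialEvalGS hθ v F, fun x => ⟨sliceGS F x, fun _ => rfl, rfl⟩, rfl⟩⟩
  obtain ⟨K, hK⟩ := u.2 ε hε
  obtain ⟨K', hK'⟩ := v.2 ε hε
  exact ⟨K * K', fun F M hM =>
    (hK _ _ (partialEval_GSBound hθ hK' F hM)).trans (le_of_eq (mul_assoc _ _ _).symm)⟩

theorem IsTensorProduct.unique {θ : ℝ} {d₁ d₂ : ℕ} {u : GSDual θ d₁} {v : GSDual θ d₂}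
    {w w' : GSDual θ (d₁ + d₂)} (h : IsTensorProduct u v w) (h' : IsTensorProduct u v w') :
    w = w' := by
  refine Subtype.ext (LinearMap.ext fun f => ?_)
  obtain ⟨g, hg, hw⟩ := h f
  obtain ⟨g', hg', hw'⟩ := h' f
  have e : g = g' := by
    refine Subtype.ext (funext fun x => ?_)
    obtain ⟨k, hk, hgk⟩ := hg x
    obtain ⟨k', hk', hgk'⟩ := hg' x
    have : k = k' := Subtype.ext (funext fun y => (hk y).trans (hk' y).symm)
    rw [hgk, hgk', this]
  subst e
  exact hw.trans hw'.symm

/-- `⟨u ⊗ v, f ⊗ g⟩ = ⟨u, f⟩⟨v, g⟩`. -/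
theorem IsTensorProduct.eval_mul {θ : ℝ} {d₁ d₂ : ℕ} {u : GSDual θ d₁} {v : GSDual θ d₂}
    {w : GSDual θ (d₁ + d₂)} (h : IsTensorProduct u v w) (F : GS θ (d₁ + d₂)) (f : GS θ d₁)
    (g : GS θ d₂) (hF : ∀ x y, (F : RSpace (d₁ + d₂) → ℂ) (join x y)
      = (f : RSpace d₁ → ℂ) x * (g : RSpace d₂ → ℂ) y) :
    w.eval F = u.eval f * v.eval g := by
  obtain ⟨G, hG, hw⟩ := h F
  have e : G = v.eval g • f := by
    refine Subtype.ext (funext fun x => ?_)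
    obtain ⟨k, hk, hGk⟩ := hG x
    have : k = (f : RSpace d₁ → ℂ) x • g :=
      Subtype.ext (funext fun y => (hk y).trans (hF x y))
    rw [hGk, this]
    exact (v.1.map_smul _ _).trans (mul_comm _ _)
  rw [hw, e]
  exact (u.1.map_smul _ _).trans (mul_comm _ _)

/-- The projection of `ℂ^{d₁+d₂}` to the first `d₁` coordinates. -/
def fstC {d₁ d₂ : ℕ} (z : CSpace (d₁ + d₂)) : CSpace d₁ :=
  WithLp.toLp 2 fun i => z (Fin.castAdd d₂ i)

/-- The projection of `ℂ^{d₁+d₂}` to the last `d₂` coordinates. -/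
def sndC {d₁ d₂ : ℕ} (z : CSpace (d₁ + d₂)) : CSpace d₂ :=
  WithLp.toLp 2 fun j => z (Fin.natAdd d₁ j)

theorem continuous_fstC {d₁ d₂ : ℕ} : Continuous (fstC : CSpace (d₁ + d₂) → CSpace d₁) :=
  (PiLp.continuous_toLp 2 _).comp (by fun_prop)

theorem continuous_sndC {d₁ d₂ : ℕ} : Continuous (sndC : CSpace (d₁ + d₂) → CSpace d₂) :=
  (PiLp.continuous_toLp 2 _).comp (by fun_prop)

theorem continuous_fstR {d₁ d₂ : ℕ} : Continuous (fstR : RSpace (d₁ + d₂) → RSpace d₁) :=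
  (PiLp.continuous_toLp 2 _).comp (by fun_prop)

theorem continuous_sndR {d₁ d₂ : ℕ} : Continuous (sndR : RSpace (d₁ + d₂) → RSpace d₂) :=
  (PiLp.continuous_toLp 2 _).comp (by fun_prop)

theorem norm_le_fstC_add_sndC {d₁ d₂ : ℕ} (z : CSpace (d₁ + d₂)) :
    ‖z‖ ≤ ‖fstC z‖ + ‖sndC z‖ := by
  refine le_of_sq_le_sq ?_ (by positivity)
  have h : ‖z‖ ^ 2 = ‖fstC z‖ ^ 2 + ‖sndC z‖ ^ 2 := by
    simp only [EuclideanSpace.norm_sq_eq, Fin.sum_univ_add]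
    rfl
  nlinarith [norm_nonneg (fstC z), norm_nonneg (sndC z)]

theorem fstC_smul {d₁ d₂ : ℕ} (t : ℝ) (z : CSpace (d₁ + d₂)) : fstC (t • z) = t • fstC z := rfl

theorem sndC_smul {d₁ d₂ : ℕ} (t : ℝ) (z : CSpace (d₁ + d₂)) : sndC (t • z) = t • sndC z := rfl

/-! ### Direct sums of phases -/

section Blocks

variable {d₁ d₂ : ℕ} (P : Matrix (Fin d₁) (Fin d₁) ℂ) (Q : Matrix (Fin d₂) (Fin d₂) ℂ)
  (w : Fin (d₁ + d₂) → ℂ)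

theorem blocks_mulVec_castAdd (i : Fin d₁) :
    ((Matrix.fromBlocks P 0 0 Q).reindex finSumFinEquiv finSumFinEquiv *ᵥ w) (Fin.castAdd d₂ i)
      = (P *ᵥ fun i => w (Fin.castAdd d₂ i)) i := by
  simp [Matrix.mulVec, dotProduct, Fin.sum_univ_add]

theorem blocks_mulVec_natAdd (j : Fin d₂) :
    ((Matrix.fromBlocks P 0 0 Q).reindex finSumFinEquiv finSumFinEquiv *ᵥ w) (Fin.natAdd d₁ j)
      = (Q *ᵥ fun j => w (Fin.natAdd d₁ j)) j := by
  simp [Matrix.mulVec, dotProduct, Fin.sum_univ_add]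

theorem blocks_dotProduct (w' : Fin (d₁ + d₂) → ℂ) :
    ((Matrix.fromBlocks P 0 0 Q).reindex finSumFinEquiv finSumFinEquiv *ᵥ w) ⬝ᵥ w'
      = (P *ᵥ fun i => w (Fin.castAdd d₂ i)) ⬝ᵥ (fun i => w' (Fin.castAdd d₂ i))
        + (Q *ᵥ fun j => w (Fin.natAdd d₁ j)) ⬝ᵥ (fun j => w' (Fin.natAdd d₁ j)) := by
  rw [dotProduct, Fin.sum_univ_add]
  simp only [blocks_mulVec_castAdd, blocks_mulVec_natAdd]
  rfl

end Blocks

namespace FBIPhase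

theorem B_mulVec_chi {d : ℕ} (φ : FBIPhase d) (p : PhaseSpace d) :
    φ.B *ᵥ (φ.chi p).ofLp = -(toC p.2 + φ.C *ᵥ toC p.1) := by
  rw [chi, Matrix.mulVec_neg, Matrix.mulVec_mulVec,
    Matrix.mul_nonsing_inv _ (isUnit_iff_ne_zero.2 φ.detB), Matrix.one_mulVec]

theorem eq_chi {d : ℕ} (φ : FBIPhase d) (p : PhaseSpace d) (z : CSpace d)
    (h : φ.B *ᵥ z.ofLp = -(toC p.2 + φ.C *ᵥ toC p.1)) : z = φ.chi p := by
  rw [← B_mulVec_chi] at h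
  exact WithLp.ofLp_injective 2
    (Matrix.mulVec_injective_of_isUnit ((Matrix.isUnit_iff_isUnit_det _).2
      (isUnit_iff_ne_zero.2 φ.detB)) h)

variable {d₁ d₂ : ℕ} (φ₁ : FBIPhase d₁) (φ₂ : FBIPhase d₂)

theorem form_directSum (z : CSpace (d₁ + d₂)) (x : RSpace d₁) (y : RSpace d₂) :
    (φ₁.directSum φ₂).form z (join x y) = φ₁.form (fstC z) x + φ₂.form (sndC z) y := by
  have e1 : (fun i => toC (join x y) (Fin.castAdd d₂ i)) = toC x := by
    funext i; simp [toC]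
  have e2 : (fun j => toC (join x y) (Fin.natAdd d₁ j)) = toC y := by
    funext j; simp [toC]
  simp only [form, directSum, blocks_dotProduct, e1, e2, fstC, sndC]
  ring

theorem packet_directSum (z : CSpace (d₁ + d₂)) (x : RSpace d₁) (y : RSpace d₂) :
    (φ₁.directSum φ₂).packet z (join x y)
      = φ₁.packet (fstC z) x * φ₂.packet (sndC z) y := by
  rw [packet, packet, packet, form_directSum, mul_add, Complex.exp_add]

theorem weight_add_le (z : CSpace (d₁ + d₂)) :
    φ₁.weight (fstC z) + φ₂.weight (sndC z) ≤ (φ₁.directSum φ₂).weight z := by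
  refine ciSup_add_ciSup_le fun x y => ?_
  have h := (φ₁.directSum φ₂).le_weight z (join x y)
  rw [form_directSum, Complex.add_im] at h
  linarith

theorem fstC_chi (p : PhaseSpace (d₁ + d₂)) :
    fstC ((φ₁.directSum φ₂).chi p) = φ₁.chi (fstR p.1, fstR p.2) := by
  refine eq_chi _ _ _ (funext fun i => ?_)
  have h := congrFun ((φ₁.directSum φ₂).B_mulVec_chi p) (Fin.castAdd d₂ i)
  simp only [directSum, Pi.neg_apply, Pi.add_apply, blocks_mulVec_castAdd] at h
  exact h

theorem sndC_chi (p : PhaseSpace (d₁ + d₂)) :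
    sndC ((φ₁.directSum φ₂).chi p) = φ₂.chi (sndR p.1, sndR p.2) := by
  refine eq_chi _ _ _ (funext fun j => ?_)
  have h := congrFun ((φ₁.directSum φ₂).B_mulVec_chi p) (Fin.natAdd d₁ j)
  simp only [directSum, Pi.neg_apply, Pi.add_apply, blocks_mulVec_natAdd] at h
  exact h

end FBIPhase

/-! ### The wave front set of a tensor product -/

theorem exists_norm_fbiTransform_le {d : ℕ} {θ δ : ℝ} (hθ : 1 / 2 ≤ θ) (hθ' : θ ≤ 1)
    (hδ : 0 < δ) (φ : FBIPhase d) (u : GSDual θ d) :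
    ∃ K : ℝ, ∀ z, ‖fbiTransform hθ φ u z‖
      ≤ K * Real.exp (δ * ‖z‖ ^ (1 / θ) + φ.weight z) := by
  obtain ⟨C, hC, h⟩ := φ.exists_packet_GSBound hθ hθ' hδ
  obtain ⟨K, hK⟩ := u.2 C hC
  refine ⟨‖(φ.const : ℂ)‖ * (K * 2), fun z => ?_⟩
  rw [fbiTransform, norm_mul, mul_assoc, mul_assoc]
  exact mul_le_mul_of_nonneg_left (hK ⟨φ.packet z, φ.packet_mem_GS hθ z⟩ _ (h z)) (norm_nonneg _)

theorem FBIPhase.const_ne_zero {d : ℕ} (φ : FBIPhase d) : φ.const ≠ 0 := by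
  have h1 := Real.rpow_pos_of_pos φ.posC.det_pos (-(1 / 4))
  have h2 := norm_pos_iff.2 φ.detB
  unfold FBIPhase.const
  positivity

theorem exists_fbiTransform_tensor {θ : ℝ} (hθ : 1 / 2 ≤ θ) {d₁ d₂ : ℕ} (φ₁ : FBIPhase d₁)
    (φ₂ : FBIPhase d₂) {u : GSDual θ d₁} {v : GSDual θ d₂} {w : GSDual θ (d₁ + d₂)}
    (h : IsTensorProduct u v w) :
    ∃ c : ℂ, ∀ z, fbiTransform hθ (φ₁.directSum φ₂) w z
      = c * (fbiTransform hθ φ₁ u (fstC z) * fbiTransform hθ φ₂ v (sndC z)) := by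
  refine ⟨(φ₁.directSum φ₂).const / (φ₁.const * φ₂.const), fun z => ?_⟩
  have h1 : (φ₁.const : ℂ) ≠ 0 := Complex.ofReal_ne_zero.2 φ₁.const_ne_zero
  have h2 : (φ₂.const : ℂ) ≠ 0 := Complex.ofReal_ne_zero.2 φ₂.const_ne_zero
  rw [fbiTransform, fbiTransform, fbiTransform,
    h.eval_mul _ ⟨φ₁.packet (fstC z), φ₁.packet_mem_GS hθ _⟩
      ⟨φ₂.packet (sndC z), φ₂.packet_mem_GS hθ _⟩ (φ₁.packet_directSum φ₂ z)]
  field_simp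

/-- Decay in `a` beats growth in `b` where `b < R a`. -/
theorem neg_mul_rpow_add_le {q R ε a b c : ℝ} (hq : 0 ≤ q) (hR : 0 < R) (hε : 0 < ε)
    (hb : 0 ≤ b) (hc : 0 ≤ c) (hba : b ≤ R * a) (hcab : c ≤ a + b) :
    -ε * a ^ q + ε / (2 * R ^ q) * b ^ q ≤ -(ε / (2 * (1 + R) ^ q)) * c ^ q := by
  have ha : 0 ≤ a := by
    by_contra h
    push Not at h
    nlinarith
  have h1 : b ^ q ≤ R ^ q * a ^ q := by
    rw [← Real.mul_rpow hR.le ha]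
    exact Real.rpow_le_rpow hb hba hq
  have h2 : c ^ q ≤ (1 + R) ^ q * a ^ q := by
    rw [← Real.mul_rpow (by linarith) ha]
    exact Real.rpow_le_rpow hc (by linarith) hq
  have h3 : ε / (2 * R ^ q) * b ^ q ≤ ε / 2 * a ^ q := by
    calc _ ≤ ε / (2 * R ^ q) * (R ^ q * a ^ q) := by gcongr
      _ = _ := by field_simp
  have h4 : ε / (2 * (1 + R) ^ q) * c ^ q ≤ ε / 2 * a ^ q := by
    calc _ ≤ ε / (2 * (1 + R) ^ q) * ((1 + R) ^ q * a ^ q) := by gcongr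
      _ = _ := by field_simp
  linarith

/-- A product of a function that decays in a cone and a function of subexponential growth decays
in a cone. -/
theorem exists_cone_of_mul {n a b : ℕ} {q : ℝ} (hq : 0 ≤ q)
    {f : CSpace n → CSpace a} {g : CSpace n → CSpace b} (hf : Continuous f) (hg : Continuous g)
    (hfs : ∀ (t : ℝ) z, f (t • z) = t • f z) (hgs : ∀ (t : ℝ) z, g (t • z) = t • g z)
    (hfg : ∀ z, ‖z‖ ≤ ‖f z‖ + ‖g z‖)
    {T : CSpace n → ℂ} {S : CSpace a → ℂ} {S' : CSpace b → ℂ} {c : ℂ}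
    (hT : ∀ z, T z = c * (S (f z) * S' (g z)))
    {W : CSpace n → ℝ} {V : CSpace a → ℝ} {V' : CSpace b → ℝ}
    (hW : ∀ z, V (f z) + V' (g z) ≤ W z)
    (hS' : ∀ δ > 0, ∃ K : ℝ, ∀ z, ‖S' z‖ ≤ K * Real.exp (δ * ‖z‖ ^ q + V' z))
    {z₀ : CSpace n} {L : Set (CSpace a)} (hLo : IsOpen L) (hLc : IsConic L) (hL0 : (0 : CSpace a) ∉ L)
    (hz₀ : f z₀ ∈ L) {ε K : ℝ} (hε : 0 < ε)
    (hS : ∀ z ∈ L, ‖S z‖ ≤ K * Real.exp (-ε * ‖z‖ ^ q + V z)) :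
    ∃ L' : Set (CSpace n), IsOpen L' ∧ IsConic L' ∧ (0 : CSpace n) ∉ L' ∧ z₀ ∈ L' ∧
      ∃ ε' > 0, ∃ K' : ℝ, ∀ z ∈ L', ‖T z‖ ≤ K' * Real.exp (-ε' * ‖z‖ ^ q + W z) := by
  have hne : 0 < ‖f z₀‖ := norm_pos_iff.2 fun h => hL0 (h ▸ hz₀)
  set R : ℝ := ‖g z₀‖ / ‖f z₀‖ + 1 with hR
  have hR0 : 0 < R := by positivity
  obtain ⟨K₂, hK₂⟩ := hS' (ε / (2 * R ^ q)) (by positivity)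
  refine ⟨{z | f z ∈ L ∧ ‖g z‖ < R * ‖f z‖}, ?_, ?_, ?_, ⟨hz₀, ?_⟩,
    ε / (2 * (1 + R) ^ q), by positivity, ‖c‖ * (|K| * |K₂|), ?_⟩
  · exact (hLo.preimage hf).inter (isOpen_lt hg.norm (continuous_const.mul hf.norm))
  · rintro z ⟨h1, h2⟩ t ht
    refine ⟨?_, ?_⟩
    · rw [hfs]; exact hLc _ h1 t ht
    · rw [hfs, hgs, norm_smul, norm_smul, mul_left_comm]
      exact mul_lt_mul_of_pos_left h2 (norm_pos_iff.2 ht.ne')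
  · rintro ⟨h1, _⟩
    have : f 0 = 0 := by simpa using hfs 0 0
    exact hL0 (this ▸ h1)
  · rw [hR, add_mul, div_mul_cancel₀ _ hne.ne']
    linarith
  · rintro z ⟨h1, h2⟩
    have b1 : ‖S (f z)‖ ≤ |K| * Real.exp (-ε * ‖f z‖ ^ q + V (f z)) :=
      (hS _ h1).trans (mul_le_mul_of_nonneg_right (le_abs_self K) (Real.exp_pos _).le)
    have b2 : ‖S' (g z)‖ ≤ |K₂| * Real.exp (ε / (2 * R ^ q) * ‖g z‖ ^ q + V' (g z)) :=
      (hK₂ _).trans (mul_le_mul_of_nonneg_right (le_abs_self K₂) (Real.exp_pos _).le)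
    rw [hT, norm_mul, norm_mul, mul_assoc]
    refine mul_le_mul_of_nonneg_left ?_ (norm_nonneg c)
    calc ‖S (f z)‖ * ‖S' (g z)‖
        ≤ (|K| * Real.exp (-ε * ‖f z‖ ^ q + V (f z)))
          * (|K₂| * Real.exp (ε / (2 * R ^ q) * ‖g z‖ ^ q + V' (g z))) := by gcongr
      _ = |K| * |K₂| * Real.exp ((-ε * ‖f z‖ ^ q + ε / (2 * R ^ q) * ‖g z‖ ^ q)
          + (V (f z) + V' (g z))) := by
          rw [mul_mul_mul_comm, ← Real.exp_add]
          congr 2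
          ring
      _ ≤ _ := by
          have h3 := neg_mul_rpow_add_le hq hR0 hε (norm_nonneg (g z)) (norm_nonneg z) h2.le
            (hfg z)
          have h4 := hW z
          gcongr

theorem isClosed_union_zero {d : ℕ} {Γ : Set (PhaseSpace d)} (h : IsClosedCone Γ) :
    IsClosed (Γ ∪ {0}) := by
  refine isClosed_of_closure_subset ?_
  rw [closure_union, isClosed_singleton.closure_eq]
  exact Set.union_subset h.2.2 Set.subset_union_right

theorem IsConic.union_zero {E : Type*} [AddMonoid E] [DistribSMul ℝ E] {Γ : Set E}
    (h : IsConic Γ) : IsConic (Γ ∪ {0}) := by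
  rintro p (hp | hp) t ht
  · exact Or.inl (h p hp t ht)
  · right
    rw [Set.mem_singleton_iff] at hp ⊢
    rw [hp, smul_zero]

theorem isClosedCone_prodCone {d₁ d₂ : ℕ} {Γ₁ : Set (PhaseSpace d₁)} {Γ₂ : Set (PhaseSpace d₂)}
    (h₁ : IsClosedCone Γ₁) (h₂ : IsClosedCone Γ₂) : IsClosedCone (prodCone Γ₁ Γ₂) := by
  refine ⟨fun h => h.2 rfl, ?_, ?_⟩
  · rintro p ⟨⟨hp₁, hp₂⟩, hp⟩ t ht
    exact ⟨⟨h₁.2.1.union_zero _ hp₁ t ht, h₂.2.1.union_zero _ hp₂ t ht⟩,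
      smul_ne_zero ht.ne' hp⟩
  · have hc : IsClosed {p : PhaseSpace (d₁ + d₂) |
        (fstR p.1, fstR p.2) ∈ Γ₁ ∪ {0} ∧ (sndR p.1, sndR p.2) ∈ Γ₂ ∪ {0}} :=
      ((isClosed_union_zero h₁).preimage ((continuous_fstR.comp continuous_fst).prodMk
        (continuous_fstR.comp continuous_snd))).inter
      ((isClosed_union_zero h₂).preimage ((continuous_sndR.comp continuous_fst).prodMk
        (continuous_sndR.comp continuous_snd)))
    intro p hp
    have := closure_minimal Set.sdiff_subset hc hp
    by_cases h0 : p = 0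
    · exact Or.inr h0
    · exact Or.inl ⟨this, h0⟩

theorem exists_cone_of_notMem {d : ℕ} {θ : ℝ} {hθ : 1 / 2 ≤ θ} {φ : FBIPhase d}
    {Γ : Set (PhaseSpace d)} {u : GSDual θ d} (hu : u ∈ GSDualCone hθ φ Γ) {p : PhaseSpace d}
    (hp : p ∉ Γ ∪ {0}) :
    ∃ L : Set (CSpace d), IsOpen L ∧ IsConic L ∧ (0 : CSpace d) ∉ L ∧ φ.chi p ∈ L ∧
      ∃ ε > 0, ∃ K : ℝ, ∀ z ∈ L,
        ‖fbiTransform hθ φ u z‖ ≤ K * Real.exp (-ε * ‖z‖ ^ (1 / θ) + φ.weight z) := by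
  by_contra h
  exact hp (Or.inl (hu ⟨fun h0 => hp (Or.inr h0), h⟩))

theorem IsTensorProduct.mem_GSDualCone {θ : ℝ} {hθ : 1 / 2 ≤ θ} (hθ' : θ ≤ 1) {d₁ d₂ : ℕ}
    {φ₁ : FBIPhase d₁} {φ₂ : FBIPhase d₂} {Γ₁ : Set (PhaseSpace d₁)} {Γ₂ : Set (PhaseSpace d₂)}
    {u : GSDual θ d₁} {v : GSDual θ d₂} (hu : u ∈ GSDualCone hθ φ₁ Γ₁)
    (hv : v ∈ GSDualCone hθ φ₂ Γ₂) {w : GSDual θ (d₁ + d₂)} (hw : IsTensorProduct u v w) :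
    w ∈ GSDualCone hθ (φ₁.directSum φ₂) (prodCone Γ₁ Γ₂) := by
  rintro p ⟨hp0, hp⟩
  obtain ⟨c, hc⟩ := exists_fbiTransform_tensor hθ φ₁ φ₂ hw
  have hq : 0 ≤ 1 / θ := by
    have : 0 < θ := by linarith
    positivity
  refine ⟨⟨?_, ?_⟩, hp0⟩
  · by_contra h₁
    obtain ⟨L, hLo, hLc, hL0, hL, ε, hε, K, hK⟩ := exists_cone_of_notMem hu h₁
    exact hp (exists_cone_of_mul hq continuous_fstC continuous_sndC fstC_smul sndC_smul
      norm_le_fstC_add_sndC hc (φ₁.weight_add_le φ₂)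
      (fun δ hδ => exists_norm_fbiTransform_le hθ hθ' hδ φ₂ v) hLo hLc hL0
      (by rwa [FBIPhase.fstC_chi]) hε hK)
  · by_contra h₂
    obtain ⟨L, hLo, hLc, hL0, hL, ε, hε, K, hK⟩ := exists_cone_of_notMem hv h₂
    exact hp (exists_cone_of_mul hq continuous_sndC continuous_fstC sndC_smul fstC_smul
      (fun z => (norm_le_fstC_add_sndC z).trans_eq (add_comm _ _))
      (fun z => (hc z).trans (by rw [mul_comm (fbiTransform hθ φ₁ u _)]))
      (fun z => (add_comm _ _).trans_le (φ₁.weight_add_le φ₂ z))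
      (fun δ hδ => exists_norm_fbiTransform_le hθ hθ' hδ φ₁ u) hLo hLc hL0
      (by rwa [FBIPhase.sndC_chi]) hε hK)

end GelfandShilov

theorem mainTheorem11 {θ : ℝ} (hθ : 1 / 2 ≤ θ) (hθ' : θ < 1) {d₁ d₂ : ℕ}
    (φ₁ : FBIPhase d₁) (φ₂ : FBIPhase d₂)
    (Γ₁ : Set (PhaseSpace d₁)) (Γ₂ : Set (PhaseSpace d₂))
    (hΓ₁ : IsClosedCone Γ₁) (hΓ₂ : IsClosedCone Γ₂)
    (u : GSDual θ d₁) (v : GSDual θ d₂)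
    (hu : u ∈ GSDualCone hθ φ₁ Γ₁) (hv : v ∈ GSDualCone hθ φ₂ Γ₂) :
    IsClosedCone (prodCone Γ₁ Γ₂) ∧
      (∃! w : GSDual θ (d₁ + d₂), IsTensorProduct u v w) ∧
      ∀ w : GSDual θ (d₁ + d₂), IsTensorProduct u v w →
        w ∈ GSDualCone hθ (φ₁.directSum φ₂) (prodCone Γ₁ Γ₂) := by
  obtain ⟨w, hw⟩ := exists_isTensorProduct hθ'.le u v
  exact ⟨isClosedCone_prodCone hΓ₁ hΓ₂, ⟨w, hw, fun _ hw' => hw'.unique hw⟩,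
    fun _ hw' => hw'.mem_GSDualCone hθ'.le hu hv⟩
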